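/- **Setting.** Let $m, K \ge 1$, $\zeta_M, \zeta_v > 0$, $c_f > 0$, $L \ge 0$ and $p \in (0,1]$. Let $Q \in \mathbb{R}^{r\times r}$ be symmetric positive definite with $\|Q\|_F \le \zeta_M$, and put $\psi_Q(x,x';u) = \|x-u\|_Q^2 - \|x'-u\|_Q^2$, where $\|z\|_Q^2 = z^\top Q z$. Users $k = 1,\dots,K$ have ideal points $u_k \in \mathbb{R}^r$ whose pseudo-ideal points $v_k = -2Qu_k$ satisfy $\|v_k\| \le \zeta_v$. The items form a set $\mathcal{X} \subset \mathbb{R}^r$ with $\|x\| \le 1$ for all $x \in \mathcal{X}$. The link function $f : \mathbb{R} \to [0,1]$ is strictly increasing with $f(z) = 1 - f(-z)$; on $|z| \le 2(\zeta_M + \zeta_v)$ it is differentiable with $f'(z) \ge c_f$, and $z \mapsto -\log f(z)$ is $L$-Lipschitz there. A collection of $m$ item pairs $(x_{i_0}, x_{i_1})_{i \le m}$ induces the design $D : \mathrm{Sym}(\mathbb{R}^r) \oplus \mathbb{R}^r \to \mathbb{R}^m$, $$D(A,w)_i = \langle x_{i_0}x_{i_0}^\top - x_{i_1}x_{i_1}^\top,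 A\rangle + \langle x_{i_0} - x_{i_1}, w\rangle ,$$ where $\mathrm{Sym}(\mathbb{R}^r)$ (the symmetric matrices) carries the trace inner product and $\oplus$ is the direct sum of inner product spaces. Let $\mathcal{P}_m$ be a probability distribution on $(\mathbb{R}^r \times \mathbb{R}^r)^m$ under which the $m$ item pairs are independent and almost surely consist of items of $\mathcal{X}$. Put $\sigma_{\min}^2(\mathcal{P}_m) = \frac{1}{m}\,\sigma_{\min}\big(\mathbb{E}_{D \sim \mathcal{P}_m}[D^*D]\big)$, where $\sigma_{\min}$ is the least singular value, and suppose that it is positive. The users' designs $D_1, \dots, D_K$ (collections of item pairs $(x_{i_0;k}, x_{i_1;k})_{i\le m}$) are i.i.d. with law $\mathcal{P}_m$. Given all the designs, the responses $Y_{i;k} \in \{-1,+1\}$ are independent, with $\Pr[Y_{i;k} = y] = f\big(y\,\psi_Q(x_{i_0;k}, x_{i_1;k}; u_k)\big)$. **Algorithm (maximum likelihood).** With the loss $\ell(z) = -\log f(z)$, minimize $$\sum_{k=1}^K \sum_{i=1}^m \ell\big(Y_{i;k}\, D_k(A, w_k)_i\big)$$ over symmetric $A \in \mathbb{R}^{r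 \times r}$ and $w_1, \dots, w_K \in \mathbb{R}^r$ subject to $A \succeq 0$, $\|A\|_F \le \zeta_M$ and $\|w_k\| \le \zeta_v$ for all $k$, and return the component $\hat Q = A$ of a minimizer. **Proposition.** With probability at least $1-p$, a minimizer exists, and every matrix $\hat Q$ that the algorithm can return is positive semidefinite and satisfies $$\|\hat Q - Q\|_F^2 \le \frac{16 L}{c_f^2\, \sigma_{\min}^2(\mathcal{P}_m)} \sqrt{\frac{(\zeta_M^2 + K\zeta_v^2)\log\frac{4}{p}}{mK}} .$$ -/

import Mathlib

open MeasureTheory ProbabilityTheory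
open scoped NNReal ENNReal Matrix Matrix.Norms.Frobenius

noncomputable section

namespace MetricLearning

/-- The item space `ℝ^r` with its Euclidean norm. -/
abbrev Item (r : ℕ) : Type := EuclideanSpace ℝ (Fin r)

/-- A collection of `m` item pairs. -/
abbrev ItemPairs (r m : ℕ) : Type := Fin m → Item r × Item r

/-- The Mahalanobis distance `ρ(x, x') = √((x - x')ᵀ M (x - x'))` with matrix `M`. -/
def mahalanobis {r : ℕ} (M : Matrix (Fin r) (Fin r) ℝ) (x x' : Item r) : ℝ :=
  √((x - x').ofLp ⬝ᵥ (M *ᵥ (x - x').ofLp))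

/-- The unquantized measurement `ψ_M(x, x'; u) = ‖x - u‖_M² - ‖x' - u‖_M²` of a user with
ideal point `u`. -/
def psi {r : ℕ} (M : Matrix (Fin r) (Fin r) ℝ) (x x' u : Item r) : ℝ :=
  mahalanobis M x u ^ 2 - mahalanobis M x' u ^ 2

/-- The pseudo-ideal point `v = -2 M u`. -/
def pseudoIdealPoint {r : ℕ} (M : Matrix (Fin r) (Fin r) ℝ) (u : Item r) : Item r :=
  WithLp.toLp 2 ((-2 : ℝ) • (M *ᵥ u.ofLp))

/-- `Δ = x xᵀ - x' x'ᵀ`. -/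
def deltaMatrix {r : ℕ} (x x' : Item r) : Matrix (Fin r) (Fin r) ℝ :=
  Matrix.vecMulVec x.ofLp x.ofLp - Matrix.vecMulVec x'.ofLp x'.ofLp

/-- `⟨x xᵀ - x' x'ᵀ, A⟩ + ⟨x - x', w⟩`, with the trace inner product of matrices. -/
def measurement {r : ℕ} (x x' : Item r) (A : Matrix (Fin r) (Fin r) ℝ) (w : Item r) : ℝ :=
  ((deltaMatrix x x')ᵀ * A).trace + inner ℝ (x - x') w

/-- `Sym(ℝ^r)` with the trace inner product: the symmetric arrays inside the Euclidean space of
all `r × r` arrays, whose inner product is the sum of the products of the entries. -/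
def symSpace (r : ℕ) : Submodule ℝ (EuclideanSpace ℝ (Fin r × Fin r)) where
  carrier := {S | ∀ i j, S (i, j) = S (j, i)}
  add_mem' := fun {S T} hS hT i j => by simp [hS i j, hT i j]
  zero_mem' := fun i j => by simp
  smul_mem' := fun c S hS i j => by simp [hS i j]

/-- The matrix with the entries of an element of `Sym(ℝ^r)`. -/
def symMatrix {r : ℕ} (S : symSpace r) : Matrix (Fin r) (Fin r) ℝ :=
  Matrix.of fun i j => S.1 (i, j)

/-- The direct sum of inner product spaces `Sym(ℝ^r) ⊕ ℝ^r`. -/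
abbrev ParamSpace (r : ℕ) : Type := WithLp 2 (symSpace r × Item r)

/-- The design matrix `D : Sym(ℝ^r) ⊕ ℝ^r → ℝ^m` induced by a collection of `m` item pairs,
`D(A, w)_i = ⟨Δ_i ⊕ δ_i, A ⊕ w⟩`. -/
def designMap {r m : ℕ} (z : ItemPairs r m) : ParamSpace r →L[ℝ] EuclideanSpace ℝ (Fin m) :=
  LinearMap.toContinuousLinearMap
    { toFun := fun θ =>
        WithLp.toLp 2 fun i => measurement (z i).1 (z i).2 (symMatrix θ.fst) θ.snd
      map_add' := fun θ η => by
        ext i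
        have h : symMatrix (θ.fst + η.fst) = symMatrix θ.fst + symMatrix η.fst := by
          ext i j; simp [symMatrix]
        simp only [measurement, WithLp.add_fst, WithLp.add_snd, h, Matrix.mul_add,
          Matrix.trace_add, inner_add_right, PiLp.add_apply]
        ring
      map_smul' := fun c θ => by
        ext i
        have h : symMatrix (c • θ.fst) = c • symMatrix θ.fst := by
          ext i j; simp [symMatrix]
        simp only [measurement, WithLp.smul_fst, WithLp.smul_snd, h, Matrix.mul_smul,
          Matrix.trace_smul, inner_smul_right, PiLp.smul_apply, smul_eq_mul, RingHom.id_apply]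
        ring }

/-- `E[D* D]` for a random design `D ∼ P`. -/
def expectedGram {r m : ℕ} (P : Measure (ItemPairs r m)) : ParamSpace r →L[ℝ] ParamSpace r :=
  ∫ z, (ContinuousLinearMap.adjoint (designMap z)).comp (designMap z) ∂P

/-- `σ²_min(P_m) = (1/m) σ_min(E[D* D])`, where `σ_min` is the last of the
`dim (Sym(ℝ^r) ⊕ ℝ^r)` singular values (listed in decreasing order, from index `0`). -/
def sigmaMinSq {r m : ℕ} (P : Measure (ItemPairs r m)) : ℝ :=
  (1 / (m : ℝ)) * (expectedGram P).toLinearMap.singularValues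
    (Module.finrank ℝ (ParamSpace r) - 1)

/-- A link function: strictly increasing, `[0,1]`-valued, with `f(z) = 1 - f(-z)`. -/
structure IsLinkFunction (f : ℝ → ℝ) : Prop where
  strictMono : StrictMono f
  mem_Icc : ∀ z, f z ∈ Set.Icc (0 : ℝ) 1
  symm : ∀ z, f z = 1 - f (-z)

/-- The sampling model. The random designs `D 1, …, D K` of the users are i.i.d. with law `P`, the
responses take the values `±1`, and, given all the designs, the responses are independent and the
response `Y k i` of user `k` to the item pair `(x, x') = D k i` equals `y` with probability
`f (y * ψ_M(x, x'; u_k))`. -/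
structure IsResponseModel {r m K : ℕ} {Ω : Type*} [MeasurableSpace Ω] (μ : Measure Ω)
    (f : ℝ → ℝ) (M : Matrix (Fin r) (Fin r) ℝ) (u : Fin K → Item r)
    (P : Measure (ItemPairs r m)) (D : Fin K → Ω → ItemPairs r m)
    (Y : Fin K → Fin m → Ω → ℝ) : Prop where
  measurable_design : ∀ k, Measurable (D k)
  law_design : ∀ k, μ.map (D k) = P
  indep_design : iIndepFun D μ
  measurable_response : ∀ k i, Measurable (Y k i)
  response_sign : ∀ k i ω, Y k i ω = 1 ∨ Y k i ω = -1
  response_law : ∀ B : Set (Fin K → ItemPairs r m), MeasurableSet B →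
    ∀ y : Fin K → Fin m → ℝ, (∀ k i, y k i = 1 ∨ y k i = -1) →
      μ {ω | (fun k => D k ω) ∈ B ∧ ∀ k i, Y k i ω = y k i} =
        ∫⁻ ω in {ω | (fun k => D k ω) ∈ B},
          ∏ k, ∏ i, ENNReal.ofReal (f (y k i * psi M (D k ω i).1 (D k ω i).2 (u k))) ∂μ

/-- The objective minimized by the estimator: the total loss of `(A, w_1, …, w_K)` on the data. -/
def empiricalRisk {r m K : ℕ} (loss : ℝ → ℝ) (z : Fin K → ItemPairs r m)
    (y : Fin K → Fin m → ℝ) (A : Matrix (Fin r) (Fin r) ℝ) (w : Fin K → Item r) : ℝ :=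
  ∑ k, ∑ i, loss (y k i * measurement (z k i).1 (z k i).2 A (w k))

/-- The constraints `A ⪰ 0`, `‖A‖_F ≤ ζ_M` and `‖w_k‖ ≤ ζ_v` for all `k`. -/
def IsFeasible {r K : ℕ} (ζM ζv : ℝ) (A : Matrix (Fin r) (Fin r) ℝ) (w : Fin K → Item r) : Prop :=
  A.PosSemidef ∧ ‖A‖ ≤ ζM ∧ ∀ k, ‖w k‖ ≤ ζv

/-- `A` is a possible output of the estimator on the data `(z, y)`: for some `w` the pair `(A, w)`
minimizes the total loss under the constraints. -/
def IsEstimate {r m K : ℕ} (loss : ℝ → ℝ) (ζM ζv : ℝ) (z : Fin K → ItemPairs r m)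
    (y : Fin K → Fin m → ℝ) (A : Matrix (Fin r) (Fin r) ℝ) : Prop :=
  ∃ w : Fin K → Item r, IsFeasible ζM ζv A w ∧
    ∀ (A' : Matrix (Fin r) (Fin r) ℝ) (w' : Fin K → Item r), IsFeasible ζM ζv A' w' →
      empiricalRisk loss z y A w ≤ empiricalRisk loss z y A' w'

end MetricLearning

end

noncomputable section

namespace MetricLearning

/-! ### Convexity inequalities -/

/-! Expected excess risk is compared with empirical excess risk, both relative to the true parameter
`θ₀`, made of `Q` and the pseudo-ideal points.

Curvature: given a pair of items, the expected excess loss is a binary relative entropy, hence at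
least `cf ^ 2` times the squared error of the predicted measurement. Summed over the pairs of one
user this error is the integral of `‖D(A - Q, w - v)‖²`, which the least singular value of `E[D* D]`
bounds below by `m σ² ‖A - Q‖²`. The `K` users together give `cf² m K σ² ‖A - Q‖²`
(`IsResponseModel.le_expected_lossDiff`).

Deviation: every measurement is an inner product of a feature vector of norm at most `√8` with a
single parameter collecting the matrix and all users' vectors; feasible parameters have norm at most
`R = √(ζM² + K ζv²)`. The exponential moment of the supremum of expected minus empirical excess risk
is bounded directly, one observation at a time: symmetrization, contraction of the Lipschitz loss to
a linear functional, and a `cosh` inequality in Hilbert space that replaces independence of the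
random signs (`lintegral_expSup_empirical_le`). A Chernoff bound then gives, with probability at
least `1 - p`, a deviation of at most `16 L R √(log(4/p) m K)`
(`exists_measurableSet_deviation_le`).

A minimizer has nonpositive empirical excess risk, so its expected excess risk is at most the
deviation; dividing by `cf² m K σ²` gives the bound. A minimizer exists because the feasible set is
compact and the risk is continuous on it. -/

theorem _root_.ConvexOn.add_le_add_of_add_eq {s : Set ℝ} {f : ℝ → ℝ} (hf : ConvexOn ℝ s f)
    {a b c d : ℝ} (ha : a ∈ s) (hb : b ∈ s) (hac : a ≤ c) (hcb : c ≤ b) (h : c + d = a + b) :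
    f c + f d ≤ f a + f b := by
  rcases eq_or_lt_of_le (hac.trans hcb) with hab | hab
  · have hc : c = a := le_antisymm (hab ▸ hcb) hac
    have hd : d = b := by linarith
    rw [hc, hd]
  have hpos : 0 < b - a := sub_pos.mpr hab
  have h0 : 0 ≤ (b - c) / (b - a) := div_nonneg (by linarith) hpos.le
  have h1 : 0 ≤ (c - a) / (b - a) := div_nonneg (by linarith) hpos.le
  have hsum : (b - c) / (b - a) + (c - a) / (b - a) = 1 := by field_simp; ring
  have hsum' : (c - a) / (b - a) + (b - c) / (b - a) = 1 := by rw [add_comm, hsum]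
  have e1 := hf.2 ha hb h0 h1 hsum
  have e2 := hf.2 ha hb h1 h0 hsum'
  simp only [smul_eq_mul] at e1 e2
  have hc : (b - c) / (b - a) * a + (c - a) / (b - a) * b = c := by field_simp; ring
  have hd : (c - a) / (b - a) * a + (b - c) / (b - a) * b = d := by
    have : d = a + b - c := by linarith
    rw [this]; field_simp; ring
  rw [hc] at e1
  rw [hd] at e2
  calc f c + f d ≤ ((b - c) / (b - a) + (c - a) / (b - a)) * f a
        + ((b - c) / (b - a) + (c - a) / (b - a)) * f b := by linarith
    _ = f a + f b := by rw [hsum]; ring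

/-- If both `a` and `b` exceed the smaller of `A`, `B`, monotonicity allows `a` to be raised to `A +
B - b`; then the sums agree and convexity applies. -/
theorem exp_add_exp_le_of_weakMajorization {a b A B : ℝ} (ha : a ≤ max A B) (hb : b ≤ max A B)
    (hab : a + b ≤ A + B) : Real.exp a + Real.exp b ≤ Real.exp A + Real.exp B := by
  wlog hAB : B ≤ A generalizing A B
  · rw [add_comm (Real.exp A)]
    exact this (by rwa [max_comm]) (by rwa [max_comm]) (by linarith) (le_of_not_ge hAB)
  rw [max_eq_left hAB] at ha hb
  rcases le_total b B with h | h
  · exact add_le_add (Real.exp_le_exp.mpr ha) (Real.exp_le_exp.mpr h)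
  · have h1 : Real.exp b + Real.exp (A + B - b) ≤ Real.exp B + Real.exp A :=
      convexOn_exp.add_le_add_of_add_eq (Set.mem_univ _) (Set.mem_univ _) h hb (by ring)
    have h2 : Real.exp a ≤ Real.exp (A + B - b) := Real.exp_le_exp.mpr (by linarith)
    linarith

/-- As a function of `t = x²`, `cosh x` is a power series in `t` with nonnegative coefficients,
hence convex for `t ≥ 0`; the comparison is made term by term. -/
theorem cosh_add_cosh_le_of_sq_add_sq_eq {x y p q : ℝ} (hqx : q ^ 2 ≤ x ^ 2) (hxp : x ^ 2 ≤ p ^ 2)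
    (h : x ^ 2 + y ^ 2 = p ^ 2 + q ^ 2) :
    Real.cosh x + Real.cosh y ≤ Real.cosh p + Real.cosh q := by
  refine hasSum_le (fun n => ?_) ((Real.hasSum_cosh x).add (Real.hasSum_cosh y))
    ((Real.hasSum_cosh p).add (Real.hasSum_cosh q))
  have hc := (convexOn_pow (𝕜 := ℝ) n).add_le_add_of_add_eq (a := q ^ 2) (b := p ^ 2)
    (c := x ^ 2) (d := y ^ 2) (sq_nonneg q) (sq_nonneg p) hqx hxp (by linarith)
  simp only [← pow_mul] at hc
  rw [← add_div, ← add_div]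
  gcongr ?_ / _
  linarith

/-- By the parallelogram law, `‖a ± b‖²` have the same sum as `(‖a‖ ± ‖b‖)²`, and they lie between
these. This makes the exponential moment of a random signed sum of vectors multiplicative,
independently of the dimension. -/
theorem cosh_norm_add_add_cosh_norm_sub_le {H : Type*} [NormedAddCommGroup H]
    [InnerProductSpace ℝ H] (c : ℝ) (a b : H) :
    Real.cosh (c * ‖a + b‖) + Real.cosh (c * ‖a - b‖) ≤
      2 * (Real.cosh (c * ‖a‖) * Real.cosh (c * ‖b‖)) := by
  have h1 := norm_add_sq_real a b
  have h2 := norm_sub_sq_real a b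
  have h3 := abs_le.mp (abs_real_inner_le_norm a b)
  have hc := sq_nonneg c
  have key : Real.cosh (c * ‖a + b‖) + Real.cosh (c * ‖a - b‖) ≤
      Real.cosh (c * ‖a‖ + c * ‖b‖) + Real.cosh (c * ‖a‖ - c * ‖b‖) := by
    refine cosh_add_cosh_le_of_sq_add_sq_eq ?_ ?_ ?_
    · rw [← mul_sub, mul_pow, mul_pow]
      exact mul_le_mul_of_nonneg_left (by nlinarith) hc
    · rw [← mul_add, mul_pow, mul_pow]
      exact mul_le_mul_of_nonneg_left (by nlinarith) hc
    · rw [← mul_sub, ← mul_add, mul_pow, mul_pow, mul_pow, mul_pow, h1, h2]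
      ring
  rw [Real.cosh_add, Real.cosh_sub] at key
  linarith

/-! ### Exponential moments of suprema -/

/-- The exponential of the supremum of a family of reals. -/
def expSup {T : Type*} (u : T → ℝ) : ℝ≥0∞ := ⨆ θ, ENNReal.ofReal (Real.exp (u θ))

theorem le_expSup {T : Type*} (u : T → ℝ) (θ : T) : ENNReal.ofReal (Real.exp (u θ)) ≤ expSup u :=
  le_iSup (fun θ => ENNReal.ofReal (Real.exp (u θ))) θ

theorem measurable_expSup {T S : Type*} [Countable T] [MeasurableSpace S] {u : S → T → ℝ}
    (hu : ∀ θ, Measurable fun s => u s θ) : Measurable fun s => expSup (u s) :=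
  Measurable.iSup fun θ => ((hu θ).exp).ennreal_ofReal

/-- The contraction principle for a single sign: the nonlinear `c` may be replaced by any `t` that
dominates its values and its increments. -/
theorem expSup_add_expSup_sub_le {T : Type*} [Nonempty T] (u c t : T → ℝ)
    (h0 : ∀ θ, |c θ| ≤ |t θ|) (h : ∀ θ θ', |c θ - c θ'| ≤ |t θ - t θ'|) :
    expSup (fun θ => u θ + c θ) + expSup (fun θ => u θ - c θ) ≤
      expSup (fun θ => u θ + t θ) + expSup (fun θ => u θ - t θ) := by
  refine ENNReal.iSup_add_iSup_le fun i j => ?_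
  -- Here `i` and `j` are candidates for the two suprema on the left. The sign of `t i - t j`
  -- decides which of them should be used with `+ t`, and the maxima cover both cases.
  set A := max (u i + t i) (u j + t j)
  set B := max (u i - t i) (u j - t j)
  have hA : ENNReal.ofReal (Real.exp A) ≤ expSup (fun θ => u θ + t θ) := by
    rcases max_choice (u i + t i) (u j + t j) with h | h <;> simp only [A, h]
    · exact le_expSup (fun θ => u θ + t θ) i
    · exact le_expSup (fun θ => u θ + t θ) j
  have hB : ENNReal.ofReal (Real.exp B) ≤ expSup (fun θ => u θ - t θ) := by
    rcases max_choice (u i - t i) (u j - t j) with h | h <;> simp only [B, h]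
    · exact le_expSup (fun θ => u θ - t θ) i
    · exact le_expSup (fun θ => u θ - t θ) j
  refine le_trans ?_ (add_le_add hA hB)
  rw [← ENNReal.ofReal_add (Real.exp_pos _).le (Real.exp_pos _).le,
    ← ENNReal.ofReal_add (Real.exp_pos _).le (Real.exp_pos _).le]
  refine ENNReal.ofReal_le_ofReal (exp_add_exp_le_of_weakMajorization ?_ ?_ ?_)
  · have h1 : u i + t i ≤ max A B := (le_max_left _ _).trans (le_max_left _ _)
    have h2 : u i - t i ≤ max A B := (le_max_left _ _).trans (le_max_right _ _)
    have := le_abs_self (c i)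
    rcases abs_cases (t i) with h3 | h3 <;> linarith [h0 i]
  · have h1 : u j + t j ≤ max A B := (le_max_right _ _).trans (le_max_left _ _)
    have h2 : u j - t j ≤ max A B := (le_max_right _ _).trans (le_max_right _ _)
    have := neg_le_abs (c j)
    rcases abs_cases (t j) with h3 | h3 <;> linarith [h0 j]
  · have h1 : u i + t i ≤ A := le_max_left _ _
    have h2 : u j + t j ≤ A := le_max_right _ _
    have h3 : u i - t i ≤ B := le_max_left _ _
    have h4 : u j - t j ≤ B := le_max_right _ _
    have := le_abs_self (c i - c j)
    rcases abs_cases (t i - t j) with h5 | h5 <;> linarith [h i j]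

theorem ofReal_exp_integral_le {Ω : Type*} [MeasurableSpace Ω] {ν : Measure Ω}
    [IsProbabilityMeasure ν] {g : Ω → ℝ} (hg : Integrable g ν) :
    ENNReal.ofReal (Real.exp (∫ ω, g ω ∂ν)) ≤ ∫⁻ ω, ENNReal.ofReal (Real.exp (g ω)) ∂ν := by
  by_cases hexp : Integrable (fun ω => Real.exp (g ω)) ν
  · rw [← ofReal_integral_eq_lintegral_ofReal hexp (ae_of_all _ fun _ => (Real.exp_pos _).le)]
    exact ENNReal.ofReal_le_ofReal (convexOn_exp.map_integral_le Real.continuous_exp.continuousOn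
      isClosed_univ (ae_of_all _ fun _ => Set.mem_univ _) hg hexp)
  · have : ∫⁻ ω, ENNReal.ofReal (Real.exp (g ω)) ∂ν = ∞ := by
      by_contra h
      exact hexp ⟨Real.continuous_exp.comp_aestronglyMeasurable hg.1,
        (hasFiniteIntegral_iff_ofReal (ae_of_all _ fun _ => (Real.exp_pos _).le)).mpr
          (lt_top_iff_ne_top.mpr h)⟩
    rw [this]
    exact le_top

/-- Symmetrization: the mean is written with an independent copy `ω'` and Jensen's inequality moves
it outside. Convexity at the midpoint of `u + 2 h(ω')` and `u - 2 h(ω)` separates the two copies, so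
that they can be merged again into one average over a sign, at the price of the factor 2. -/
theorem lintegral_expSup_sub_le {T Ω : Type*} [Countable T] [Nonempty T] [MeasurableSpace Ω]
    {ν : Measure Ω} [IsProbabilityMeasure ν] (u : T → ℝ) (h : T → Ω → ℝ)
    (hm : ∀ θ, Measurable (h θ)) (hi : ∀ θ, Integrable (h θ) ν) :
    ∫⁻ ω, expSup (fun θ => u θ + (∫ ω', h θ ω' ∂ν - h θ ω)) ∂ν ≤
      ∫⁻ ω, 2⁻¹ * (expSup (fun θ => u θ + 2 * h θ ω) + expSup (fun θ => u θ - 2 * h θ ω)) ∂ν := by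
  have hp : Measurable fun ω => expSup (fun θ => u θ + 2 * h θ ω) :=
    measurable_expSup fun θ => ((hm θ).const_mul 2).const_add _
  have hn : Measurable fun ω => expSup (fun θ => u θ - 2 * h θ ω) :=
    measurable_expSup fun θ => ((hm θ).const_mul 2).const_sub _
  have hpt : ∀ ω, expSup (fun θ => u θ + (∫ ω', h θ ω' ∂ν - h θ ω)) ≤
      ∫⁻ ω', 2⁻¹ * (expSup (fun θ => u θ + 2 * h θ ω') + expSup (fun θ => u θ - 2 * h θ ω)) ∂ν := by
    refine fun ω => iSup_le fun θ => ?_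
    have hint : ∫ ω', (u θ + (h θ ω' - h θ ω)) ∂ν = u θ + (∫ ω', h θ ω' ∂ν - h θ ω) := by
      have h1 : Integrable (fun ω' => h θ ω' - h θ ω) ν := (hi θ).sub (integrable_const _)
      rw [integral_add (integrable_const _) h1, integral_sub (hi θ) (integrable_const _)]
      simp
    beta_reduce
    rw [← hint]
    refine (ofReal_exp_integral_le
      ((integrable_const _).add ((hi θ).sub (integrable_const _)))).trans
      (lintegral_mono fun ω' => ?_)
    have hconv : Real.exp (u θ + (h θ ω' - h θ ω)) ≤
        2⁻¹ * (Real.exp (u θ + 2 * h θ ω') + Real.exp (u θ - 2 * h θ ω)) := by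
      have := convexOn_exp.2 (Set.mem_univ (u θ + 2 * h θ ω')) (Set.mem_univ (u θ - 2 * h θ ω))
        (show (0 : ℝ) ≤ 2⁻¹ by norm_num) (show (0 : ℝ) ≤ 2⁻¹ by norm_num) (by norm_num)
      simp only [smul_eq_mul] at this
      calc Real.exp (u θ + (h θ ω' - h θ ω))
          = Real.exp (2⁻¹ * (u θ + 2 * h θ ω') + 2⁻¹ * (u θ - 2 * h θ ω)) := by ring_nf
        _ ≤ _ := by linarith
    refine (ENNReal.ofReal_le_ofReal hconv).trans ?_
    rw [ENNReal.ofReal_mul (by norm_num), ENNReal.ofReal_add (Real.exp_pos _).le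
      (Real.exp_pos _).le, ENNReal.ofReal_inv_of_pos two_pos, ENNReal.ofReal_ofNat]
    gcongr
    · exact le_expSup (fun θ => u θ + 2 * h θ ω') θ
    · exact le_expSup (fun θ => u θ - 2 * h θ ω) θ
  refine (lintegral_mono hpt).trans (le_of_eq ?_)
  have e1 : ∀ ω, ∫⁻ ω', 2⁻¹ * (expSup (fun θ => u θ + 2 * h θ ω') +
      expSup (fun θ => u θ - 2 * h θ ω)) ∂ν =
      2⁻¹ * (∫⁻ ω', expSup (fun θ => u θ + 2 * h θ ω') ∂ν + expSup (fun θ => u θ - 2 * h θ ω)) := by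
    intro ω
    rw [lintegral_const_mul _ (hp.add_const _), lintegral_add_left hp]
    simp
  simp_rw [e1]
  have hpn : Measurable fun ω => expSup (fun θ => u θ + 2 * h θ ω) +
      expSup (fun θ => u θ - 2 * h θ ω) := hp.add hn
  rw [lintegral_const_mul _ (hn.const_add _), lintegral_const_mul _ hpn,
    lintegral_add_left measurable_const, lintegral_add_left hp]
  simp

/-- Each induction step trades one centred nonlinear term for the linear term `± 2 ⟨Z, τ θ⟩`. The
free vector `v` carries the linear terms produced so far, which is why the induction is over all
`v`. -/
theorem lintegral_expSup_empirical_le {ι T S Ω H : Type*} [Countable T] [Nonempty T]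
    [MeasurableSpace S] [MeasurableSpace Ω] [NormedAddCommGroup H] [InnerProductSpace ℝ H]
    {μ : Measure Ω} [IsProbabilityMeasure μ] {ξ : ι → Ω → S} (hξ : ∀ i, Measurable (ξ i))
    (hind : iIndepFun ξ μ) (h : ι → T → S → ℝ) (hm : ∀ i θ, Measurable (h i θ))
    (hi : ∀ i θ, Integrable (h i θ) (μ.map (ξ i)))
    (Z : ι → S → H) (τ : T → H) (hZ : ∀ i θ, Measurable fun s => inner ℝ (Z i s) (τ θ))
    {ρ b : ℝ} (hτ : ∀ θ, ‖τ θ‖ ≤ ρ) (hb : ∀ i, ∀ᵐ s ∂(μ.map (ξ i)), ‖Z i s‖ ≤ b)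
    (h0 : ∀ i, ∀ᵐ s ∂(μ.map (ξ i)), ∀ θ, |h i θ s| ≤ |inner ℝ (Z i s) (τ θ)|)
    (hlip : ∀ i, ∀ᵐ s ∂(μ.map (ξ i)), ∀ θ θ', |h i θ s - h i θ' s| ≤
      |inner ℝ (Z i s) (τ θ) - inner ℝ (Z i s) (τ θ')|) (s : Finset ι) :
    ∀ v : H, ∫⁻ ω, expSup (fun θ => inner ℝ v (τ θ) +
        ∑ i ∈ s, (∫ x, h i θ x ∂(μ.map (ξ i)) - h i θ (ξ i ω))) ∂μ ≤
      ENNReal.ofReal (2 * (Real.cosh (ρ * ‖v‖) * Real.cosh (2 * ρ * b) ^ s.card)) := by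
  classical
  have hρ : 0 ≤ ρ := (norm_nonneg _).trans (hτ (Classical.arbitrary T))
  induction s using Finset.induction_on with
  | empty =>
    intro v
    simp only [Finset.sum_empty, add_zero, Finset.card_empty, pow_zero, mul_one, lintegral_const,
      measure_univ]
    refine iSup_le fun θ => ENNReal.ofReal_le_ofReal ?_
    have h1 : inner ℝ v (τ θ) ≤ ρ * ‖v‖ := by
      refine (real_inner_le_norm _ _).trans ?_
      rw [mul_comm]
      exact mul_le_mul_of_nonneg_right (hτ θ) (norm_nonneg _)
    have h2 := Real.exp_le_exp.mpr h1
    have h3 := Real.exp_pos (-(ρ * ‖v‖))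
    rw [Real.cosh_eq]
    linarith
  | insert i s his ih =>
    intro v
    have hprob : ∀ j, IsProbabilityMeasure (μ.map (ξ j)) :=
      fun j => Measure.isProbabilityMeasure_map (hξ j).aemeasurable
    set η : Ω → (s → S) := fun ω j => ξ j ω with hη
    have hηm : Measurable η := measurable_pi_lambda _ fun j => hξ j
    have hprobη : IsProbabilityMeasure (μ.map η) := Measure.isProbabilityMeasure_map hηm.aemeasurable
    have hindep : IndepFun η (ξ i) μ := by
      have := hind.indepFun_finset s {i} (by simpa using his) hξ
      exact this.comp measurable_id (measurable_pi_apply (⟨i, by simp⟩ : ({i} : Finset ι)))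
    let U : H → (s → S) → T → ℝ := fun w y θ => inner ℝ w (τ θ) +
      ∑ j : s, (∫ x, h j θ x ∂(μ.map (ξ j)) - h j θ (y j))
    have hUm : ∀ w θ, Measurable fun y => U w y θ := fun w θ =>
      (Finset.measurable_sum _ fun j _ =>
        ((hm j.1 θ).comp (measurable_pi_apply (X := fun _ : s => S) j)).const_sub _).const_add _
    have hU : ∀ w, ∫⁻ y, expSup (U w y) ∂(μ.map η) ≤
        ENNReal.ofReal (2 * (Real.cosh (ρ * ‖w‖) * Real.cosh (2 * ρ * b) ^ s.card)) := by
      intro w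
      rw [lintegral_map (measurable_expSup (hUm w)) hηm]
      refine le_trans (le_of_eq ?_) (ih w)
      refine lintegral_congr fun ω => ?_
      congr 1
      ext θ
      simp only [U, hη]
      rw [Finset.sum_coe_sort s fun j => (∫ x, h j θ x ∂(μ.map (ξ j)) - h j θ (ξ j ω))]
    -- The new linear term only shifts `v`, so the induction hypothesis applies again.
    have hUadd : ∀ (w : ℝ) z (y : s → S), (fun θ => U v y θ + inner ℝ (w • Z i z) (τ θ)) =
        U (v + w • Z i z) y := by
      intro w z y
      ext θ
      simp only [U, inner_add_left]
      ring
    have hGm : Measurable fun q : (s → S) × S =>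
        expSup (fun θ => U v q.1 θ + (∫ x, h i θ x ∂(μ.map (ξ i)) - h i θ q.2)) :=
      measurable_expSup fun θ => ((hUm v θ).comp measurable_fst).add
        (((hm i θ).comp measurable_snd).const_sub _)
    have htm : ∀ c : ℝ, Measurable fun q : (s → S) × S =>
        expSup (fun θ => U v q.1 θ + inner ℝ (c • Z i q.2) (τ θ)) := fun c =>
      measurable_expSup fun θ => by
        simp only [inner_smul_left]
        exact ((hUm v θ).comp measurable_fst).add (((hZ i θ).comp measurable_snd).const_mul _)
    calc ∫⁻ ω, expSup (fun θ => inner ℝ v (τ θ) +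
          ∑ j ∈ insert i s, (∫ x, h j θ x ∂(μ.map (ξ j)) - h j θ (ξ j ω))) ∂μ
        = ∫⁻ ω, expSup (fun θ => U v (η ω) θ +
            (∫ x, h i θ x ∂(μ.map (ξ i)) - h i θ (ξ i ω))) ∂μ := by
          refine lintegral_congr fun ω => ?_
          congr 1
          ext θ
          rw [Finset.sum_insert his]
          simp only [U, hη]
          rw [Finset.sum_coe_sort s fun j => (∫ x, h j θ x ∂(μ.map (ξ j)) - h j θ (ξ j ω))]
          ring
      _ = ∫⁻ y, ∫⁻ z, expSup (fun θ => U v y θ +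
            (∫ x, h i θ x ∂(μ.map (ξ i)) - h i θ z)) ∂(μ.map (ξ i)) ∂(μ.map η) := by
          rw [← lintegral_prod _ hGm.aemeasurable,
            ← (indepFun_iff_map_prod_eq_prod_map_map hηm.aemeasurable (hξ i).aemeasurable).mp
              hindep, lintegral_map hGm (hηm.prodMk (hξ i))]
      _ ≤ ∫⁻ y, ∫⁻ z, 2⁻¹ * (expSup (fun θ => U v y θ + inner ℝ ((2 : ℝ) • Z i z) (τ θ)) +
            expSup (fun θ => U v y θ + inner ℝ ((-2 : ℝ) • Z i z) (τ θ)))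
            ∂(μ.map (ξ i)) ∂(μ.map η) := by
          refine lintegral_mono fun y => ?_
          refine (lintegral_expSup_sub_le (U v y) (h i) (hm i) (hi i)).trans
            (lintegral_mono_ae ?_)
          filter_upwards [h0 i, hlip i] with z hz0 hz
          gcongr 2⁻¹ * ?_
          simp only [inner_smul_left, conj_trivial, neg_mul, ← sub_eq_add_neg]
          refine expSup_add_expSup_sub_le (U v y) (fun θ => 2 * h i θ z) _ (fun θ => ?_)
            fun θ θ' => ?_
          · rw [abs_mul, abs_mul]
            exact mul_le_mul_of_nonneg_left (hz0 θ) (abs_nonneg _)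
          · rw [← mul_sub, ← mul_sub, abs_mul, abs_mul]
            exact mul_le_mul_of_nonneg_left (hz θ θ') (abs_nonneg _)
      -- After the swap `z` is fixed in the inner integral, and the shifted vectors are constants
      -- there.
      _ = ∫⁻ z, ∫⁻ y, 2⁻¹ * (expSup (U (v + (2 : ℝ) • Z i z) y) +
            expSup (U (v + (-2 : ℝ) • Z i z) y)) ∂(μ.map η) ∂(μ.map (ξ i)) := by
          rw [lintegral_lintegral_swap (((htm 2).add (htm (-2))).const_mul _).aemeasurable]
          simp_rw [hUadd]
      _ ≤ ∫⁻ _, ENNReal.ofReal (2 * (Real.cosh (ρ * ‖v‖) *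
            Real.cosh (2 * ρ * b) ^ (insert i s).card)) ∂(μ.map (ξ i)) := by
          refine lintegral_mono_ae ?_
          filter_upwards [hb i] with z hz
          have hUU : Measurable fun y => expSup (U (v + (2 : ℝ) • Z i z) y) +
              expSup (U (v + (-2 : ℝ) • Z i z) y) :=
            (measurable_expSup (hUm _)).add (measurable_expSup (hUm _))
          rw [lintegral_const_mul _ hUU,
            lintegral_add_left (measurable_expSup (hUm _))]
          refine (mul_le_mul_right (add_le_add (hU _) (hU _)) _).trans ?_
          have hC : 0 ≤ Real.cosh (2 * ρ * b) ^ s.card := (pow_pos (Real.cosh_pos _) _).le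
          have hpos : ∀ x : ℝ, 0 ≤ 2 * (Real.cosh x * Real.cosh (2 * ρ * b) ^ s.card) := fun x =>
            mul_nonneg zero_le_two (mul_nonneg (Real.cosh_pos _).le hC)
          rw [← ENNReal.ofReal_add (hpos _) (hpos _), ← ENNReal.ofReal_ofNat (n := 2),
            ← ENNReal.ofReal_inv_of_pos two_pos, ← ENNReal.ofReal_mul (by norm_num)]
          refine ENNReal.ofReal_le_ofReal ?_
          have hcosh := cosh_norm_add_add_cosh_norm_sub_le ρ v ((2 : ℝ) • Z i z)
          have hb' : Real.cosh (ρ * ‖(2 : ℝ) • Z i z‖) ≤ Real.cosh (2 * ρ * b) := by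
            rw [Real.cosh_le_cosh, norm_smul, abs_of_nonneg (by positivity)]
            refine le_trans ?_ (le_abs_self _)
            rw [Real.norm_ofNat]
            nlinarith
          rw [Finset.card_insert_of_notMem his, pow_succ, neg_smul, ← sub_eq_add_neg]
          have h5 := mul_le_mul_of_nonneg_left hb' (Real.cosh_pos (ρ * ‖v‖)).le
          have h6 := mul_le_mul_of_nonneg_right hcosh hC
          have h7 := mul_le_mul_of_nonneg_right h5 hC
          nlinarith
      _ = _ := by simp

/-! ### Conditionally independent signs -/

theorem measurableSet_forall_mem {κ X Ω : Type*} [Countable κ] [MeasurableSpace X]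
    [MeasurableSpace Ω] {x : κ → Ω → X} (hx : ∀ i, Measurable (x i)) {B : κ → Set X}
    (hB : ∀ i, MeasurableSet (B i)) : MeasurableSet {ω | ∀ i, x i ω ∈ B i} := by
  have : {ω | ∀ i, x i ω ∈ B i} = ⋂ i, x i ⁻¹' B i := by ext ω; simp
  rw [this]
  exact MeasurableSet.iInter fun i => hx i (hB i)

section Signs

variable {κ X Ω : Type*} [Fintype κ] [MeasurableSpace X] [MeasurableSpace Ω] {μ : Measure Ω}

/-- Given the covariates `x`, the signs `y` are independent, and `y i = 1` or `y i = -1` with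
probability `g i (x i) (y i)`. -/
structure IsSignModel (μ : Measure Ω) (x : κ → Ω → X) (y : κ → Ω → ℝ)
    (g : κ → X → ℝ → ℝ) : Prop where
  measurable_covariate : ∀ i, Measurable (x i)
  indep_covariate : iIndepFun x μ
  measurable_sign : ∀ i, Measurable (y i)
  sign : ∀ i ω, y i ω = 1 ∨ y i ω = -1
  measurable_prob : ∀ i c, Measurable fun a => g i a c
  prob_nonneg : ∀ i a c, 0 ≤ g i a c
  prob_add : ∀ i a, g i a 1 + g i a (-1) = 1
  law : ∀ B : κ → Set X, (∀ i, MeasurableSet (B i)) → ∀ c : κ → ℝ, (∀ i, c i = 1 ∨ c i = -1) →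
    μ {ω | (∀ i, x i ω ∈ B i) ∧ ∀ i, y i ω = c i} =
      ∫⁻ ω in {ω | ∀ i, x i ω ∈ B i}, ∏ i, ENNReal.ofReal (g i (x i ω) (c i)) ∂μ

namespace IsSignModel

variable {x : κ → Ω → X} {y : κ → Ω → ℝ} {g : κ → X → ℝ → ℝ}

/-- Splitting over all sign vectors and using the independence of the covariates gives a sum of
products; by distributivity this is a product of sums, which yields independence of the pairs `(x i,
y i)`. -/
theorem measure_forall_mem (h : IsSignModel μ x y g) {s : κ → Set (X × ℝ)}
    (hs : ∀ i, MeasurableSet (s i)) :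
    μ {ω | ∀ i, (x i ω, y i ω) ∈ s i} = ∏ i, ∑ c ∈ ({1, -1} : Finset ℝ),
      ∫⁻ ω, ((fun a => (a, c)) ⁻¹' s i).indicator (fun a => ENNReal.ofReal (g i a c)) (x i ω) ∂μ := by
  classical
  have hsec : ∀ i (c : ℝ), MeasurableSet ((fun a => (a, c)) ⁻¹' s i : Set X) :=
    fun i c => measurable_prodMk_right (hs i)
  have hind : ∀ i (c : ℝ), Measurable (((fun a => (a, c)) ⁻¹' s i).indicator
      (fun a => ENNReal.ofReal (g i a c))) := fun i c =>
    (h.measurable_prob i c).ennreal_ofReal.indicator (hsec i c)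
  have hunion : {ω | ∀ i, (x i ω, y i ω) ∈ s i} =
      ⋃ c ∈ Fintype.piFinset (fun _ : κ => ({1, -1} : Finset ℝ)),
        {ω | (∀ i, x i ω ∈ (fun a => (a, c i)) ⁻¹' s i) ∧ ∀ i, y i ω = c i} := by
    ext ω
    simp only [Set.mem_ofPred_eq, Set.mem_iUnion, Fintype.mem_piFinset, Set.mem_preimage,
      exists_prop, Finset.mem_insert, Finset.mem_singleton]
    constructor
    · intro hω
      exact ⟨fun i => y i ω, fun i => h.sign i ω, hω, fun i => rfl⟩
    · rintro ⟨c, -, hx, hy⟩ i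
      rw [hy i]
      exact hx i
  have hmeas : ∀ c : κ → ℝ, MeasurableSet
      {ω | (∀ i, x i ω ∈ (fun a => (a, c i)) ⁻¹' s i) ∧ ∀ i, y i ω = c i} := fun c =>
    (measurableSet_forall_mem h.measurable_covariate fun i => hsec i (c i)).inter
      (measurableSet_forall_mem h.measurable_sign fun i => measurableSet_singleton (c i))
  have hdisj : (↑(Fintype.piFinset (fun _ : κ => ({1, -1} : Finset ℝ))) : Set (κ → ℝ)).PairwiseDisjoint
      fun c => {ω | (∀ i, x i ω ∈ (fun a => (a, c i)) ⁻¹' s i) ∧ ∀ i, y i ω = c i} := by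
    intro c _ c' _ hcc
    refine Set.disjoint_left.mpr fun ω hω hω' => hcc ?_
    ext i
    rw [← hω.2 i, hω'.2 i]
  rw [hunion, measure_biUnion_finset hdisj fun c _ => hmeas c, Finset.prod_univ_sum]
  refine Finset.sum_congr rfl fun c hc => ?_
  rw [h.law _ (fun i => hsec i (c i)) c fun i => by
      simpa using Fintype.mem_piFinset.mp hc i,
    ← lintegral_indicator (measurableSet_forall_mem h.measurable_covariate fun i => hsec i (c i)),
    ← lintegral_prod_eq_prod_lintegral_of_indepFun Finset.univ
      (fun i ω => ((fun a => (a, c i)) ⁻¹' s i).indicator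
        (fun a => ENNReal.ofReal (g i a (c i))) (x i ω))
      (h.indep_covariate.comp _ fun i => hind i (c i))
      fun i => (hind i (c i)).comp (h.measurable_covariate i)]
  refine lintegral_congr fun ω => ?_
  by_cases hω : ∀ i, x i ω ∈ (fun a => (a, c i)) ⁻¹' s i
  · rw [Set.indicator_of_mem (show ω ∈ {ω | ∀ i, x i ω ∈ (fun a => (a, c i)) ⁻¹' s i} from hω)]
    exact Finset.prod_congr rfl fun i _ => by rw [Set.indicator_of_mem (hω i)]
  · rw [Set.indicator_of_notMem (show ω ∉ {ω | ∀ i, x i ω ∈ (fun a => (a, c i)) ⁻¹' s i} from hω)]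
    obtain ⟨i, hi⟩ := not_forall.mp hω
    exact (Finset.prod_eq_zero (Finset.mem_univ i) (Set.indicator_of_notMem hi _)).symm

theorem measure_mem (h : IsSignModel μ x y g) [IsProbabilityMeasure μ] (i : κ) {s : Set (X × ℝ)}
    (hs : MeasurableSet s) :
    μ {ω | (x i ω, y i ω) ∈ s} = ∑ c ∈ ({1, -1} : Finset ℝ),
      ∫⁻ ω, ((fun a => (a, c)) ⁻¹' s).indicator (fun a => ENNReal.ofReal (g i a c)) (x i ω) ∂μ := by
  classical
  have key := h.measure_forall_mem (s := fun j => if j = i then s else Set.univ) fun j => by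
    split_ifs
    exacts [hs, MeasurableSet.univ]
  have hset : {ω | ∀ j, (x j ω, y j ω) ∈ if j = i then s else Set.univ} =
      {ω | (x i ω, y i ω) ∈ s} := by
    ext ω
    constructor
    · intro hω
      simpa using hω i
    · intro hω j
      split_ifs with hj
      · rw [hj]; exact hω
      · exact Set.mem_univ _
  rw [hset] at key
  rw [key, Finset.prod_eq_single i]
  · simp
  -- A coordinate without constraint contributes the factor 1, since its two sign probabilities add
  -- up to 1.
  · intro j _ hj
    simp only [hj, if_false, Set.preimage_univ, Set.indicator_univ]
    have hm : Measurable fun ω => ENNReal.ofReal (g j (x j ω) 1) :=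
      (h.measurable_prob j 1).ennreal_ofReal.comp (h.measurable_covariate j)
    rw [Finset.sum_pair (by norm_num), ← lintegral_add_left hm]
    simp_rw [← ENNReal.ofReal_add (h.prob_nonneg j _ 1) (h.prob_nonneg j _ (-1)), h.prob_add]
    simp
  · simp

theorem iIndepFun_prodMk (h : IsSignModel μ x y g) [IsProbabilityMeasure μ] :
    iIndepFun (fun i ω => (x i ω, y i ω)) μ := by
  have hm : ∀ i, Measurable fun ω => (x i ω, y i ω) := fun i =>
    (h.measurable_covariate i).prodMk (h.measurable_sign i)
  have hp : ∀ i, IsProbabilityMeasure (μ.map fun ω => (x i ω, y i ω)) := fun i =>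
    Measure.isProbabilityMeasure_map (hm i).aemeasurable
  rw [iIndepFun_iff_map_fun_eq_pi_map fun i => (hm i).aemeasurable]
  refine (Measure.pi_eq fun s hs => ?_).symm
  rw [Measure.map_apply (measurable_pi_lambda _ hm) (MeasurableSet.univ_pi hs)]
  have hset : (fun ω i => (x i ω, y i ω)) ⁻¹' Set.univ.pi s =
      {ω | ∀ i, (x i ω, y i ω) ∈ s i} := by
    ext ω; simp
  rw [hset, h.measure_forall_mem hs]
  refine Finset.prod_congr rfl fun i _ => ?_
  rw [Measure.map_apply (hm i) (hs i)]
  exact (h.measure_mem i (hs i)).symm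

theorem map_prodMk (h : IsSignModel μ x y g) [IsProbabilityMeasure μ] (i : κ) :
    μ.map (fun ω => (x i ω, y i ω)) =
      (((μ.map (x i)).withDensity fun a => ENNReal.ofReal (g i a 1)).map fun a => (a, (1 : ℝ))) +
      (((μ.map (x i)).withDensity fun a => ENNReal.ofReal (g i a (-1))).map
        fun a => (a, (-1 : ℝ))) := by
  ext s hs
  have hc : ∀ c : ℝ, (((μ.map (x i)).withDensity fun a => ENNReal.ofReal (g i a c)).map
      fun a => (a, c)) s =
      ∫⁻ ω, ((fun a => (a, c)) ⁻¹' s).indicator (fun a => ENNReal.ofReal (g i a c)) (x i ω) ∂μ := by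
    intro c
    have hsec : MeasurableSet ((fun a => (a, c)) ⁻¹' s : Set X) := measurable_prodMk_right hs
    rw [Measure.map_apply measurable_prodMk_right hs, withDensity_apply _ hsec,
      ← lintegral_indicator hsec, lintegral_map
        ((h.measurable_prob i c).ennreal_ofReal.indicator hsec) (h.measurable_covariate i)]
  rw [Measure.map_apply ((h.measurable_covariate i).prodMk (h.measurable_sign i)) hs,
    Measure.add_apply, hc, hc]
  exact (h.measure_mem i hs).trans (Finset.sum_pair (by norm_num))

theorem integral_prodMk (h : IsSignModel μ x y g) [IsProbabilityMeasure μ] (i : κ)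
    {φ : X × ℝ → ℝ} (hφ : Measurable φ)
    (hint : Integrable φ (μ.map fun ω => (x i ω, y i ω))) :
    Integrable (fun a => g i a 1 * φ (a, 1) + g i a (-1) * φ (a, -1)) (μ.map (x i)) ∧
    ∫ z, φ z ∂(μ.map fun ω => (x i ω, y i ω)) =
      ∫ a, (g i a 1 * φ (a, 1) + g i a (-1) * φ (a, -1)) ∂(μ.map (x i)) := by
  rw [h.map_prodMk i] at hint ⊢
  have hI := integrable_add_measure.mp hint
  have hc : ∀ c : ℝ, Integrable φ (((μ.map (x i)).withDensity
      fun a => ENNReal.ofReal (g i a c)).map fun a => (a, c)) →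
      Integrable (fun a => g i a c * φ (a, c)) (μ.map (x i)) ∧
      ∫ z, φ z ∂(((μ.map (x i)).withDensity fun a => ENNReal.ofReal (g i a c)).map
        fun a => (a, c)) = ∫ a, g i a c * φ (a, c) ∂(μ.map (x i)) := by
    intro c hcI
    have hg : Measurable fun a => (g i a c).toNNReal := (h.measurable_prob i c).real_toNNReal
    have hr : ∀ a, ((g i a c).toNNReal : ℝ) = g i a c := fun a =>
      Real.coe_toNNReal _ (h.prob_nonneg i a c)
    have hmk : Measurable fun a : X => (a, c) := measurable_prodMk_right
    rw [integral_map hmk.aemeasurable hφ.aestronglyMeasurable]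
    rw [integrable_map_measure hφ.aestronglyMeasurable hmk.aemeasurable] at hcI
    simp only [ENNReal.ofReal] at hcI ⊢
    rw [integrable_withDensity_iff_integrable_smul hg] at hcI
    rw [integral_withDensity_eq_integral_smul hg]
    simp only [NNReal.smul_def, hr, smul_eq_mul, Function.comp_apply] at hcI ⊢
    exact ⟨hcI, trivial⟩
  obtain ⟨h1, h1'⟩ := hc 1 hI.1
  obtain ⟨h2, h2'⟩ := hc (-1) hI.2
  exact ⟨h1.add h2, by rw [integral_add_measure hI.1 hI.2, h1', h2', integral_add h1 h2]⟩

end IsSignModel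

end Signs

/-! ### Measurements as linear functionals -/

/-- The vector of the entries of a matrix. -/
def vecMatrix {r : ℕ} (A : Matrix (Fin r) (Fin r) ℝ) : EuclideanSpace ℝ (Fin r × Fin r) :=
  WithLp.toLp 2 fun q => A q.1 q.2

/-- The matrix with the given entries. -/
def unvecMatrix {r : ℕ} (S : EuclideanSpace ℝ (Fin r × Fin r)) : Matrix (Fin r) (Fin r) ℝ :=
  Matrix.of fun i j => S (i, j)

@[simp] theorem vecMatrix_unvecMatrix {r : ℕ} (S : EuclideanSpace ℝ (Fin r × Fin r)) :
    vecMatrix (unvecMatrix S) = S := rfl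

theorem vecMatrix_sub {r : ℕ} (A B : Matrix (Fin r) (Fin r) ℝ) :
    vecMatrix (A - B) = vecMatrix A - vecMatrix B := rfl

theorem norm_vecMatrix {r : ℕ} (A : Matrix (Fin r) (Fin r) ℝ) : ‖vecMatrix A‖ = ‖A‖ := by
  rw [Matrix.frobenius_norm_def, EuclideanSpace.norm_eq, Real.sqrt_eq_rpow, Fintype.sum_prod_type]
  simp [vecMatrix]

theorem norm_unvecMatrix {r : ℕ} (S : EuclideanSpace ℝ (Fin r × Fin r)) : ‖unvecMatrix S‖ = ‖S‖ := by
  rw [← norm_vecMatrix, vecMatrix_unvecMatrix]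

theorem inner_vecMatrix {r : ℕ} (A B : Matrix (Fin r) (Fin r) ℝ) :
    inner ℝ (vecMatrix A) (vecMatrix B) = (Aᵀ * B).trace := by
  simp only [vecMatrix, PiLp.inner_apply, RCLike.inner_apply, conj_trivial, Matrix.trace,
    Matrix.diag_apply, Matrix.mul_apply, Matrix.transpose_apply]
  rw [Fintype.sum_prod_type, Finset.sum_comm]
  exact Finset.sum_congr rfl fun _ _ => Finset.sum_congr rfl fun _ _ => mul_comm _ _

theorem norm_vecMatrix_vecMulVec {r : ℕ} (x : Item r) :
    ‖vecMatrix (Matrix.vecMulVec x.ofLp x.ofLp)‖ = ‖x‖ ^ 2 := by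
  rw [EuclideanSpace.norm_sq_eq, EuclideanSpace.norm_eq,
    Real.sqrt_eq_iff_mul_self_eq (by positivity) (by positivity), Fintype.sum_prod_type,
    Finset.sum_mul_sum]
  simp [vecMatrix, Matrix.vecMulVec_apply, mul_pow]

theorem norm_vecMatrix_deltaMatrix_le {r : ℕ} {x x' : Item r} (hx : ‖x‖ ≤ 1) (hx' : ‖x'‖ ≤ 1) :
    ‖vecMatrix (deltaMatrix x x')‖ ≤ 2 := by
  rw [deltaMatrix, vecMatrix_sub]
  refine (norm_sub_le _ _).trans ?_
  rw [norm_vecMatrix_vecMulVec, norm_vecMatrix_vecMulVec]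
  have := pow_le_one₀ (n := 2) (norm_nonneg x) hx
  have := pow_le_one₀ (n := 2) (norm_nonneg x') hx'
  linarith

theorem norm_sub_le_two {r : ℕ} {x x' : Item r} (hx : ‖x‖ ≤ 1) (hx' : ‖x'‖ ≤ 1) :
    ‖x - x'‖ ≤ 2 := (norm_sub_le _ _).trans (by linarith)

theorem abs_measurement_le {r : ℕ} {x x' : Item r} (hx : ‖x‖ ≤ 1) (hx' : ‖x'‖ ≤ 1)
    {A : Matrix (Fin r) (Fin r) ℝ} {w : Item r} {ζM ζv : ℝ} (hA : ‖A‖ ≤ ζM) (hw : ‖w‖ ≤ ζv) :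
    |measurement x x' A w| ≤ 2 * (ζM + ζv) := by
  rw [measurement, ← inner_vecMatrix]
  refine (abs_add_le _ _).trans ?_
  have h1 := abs_real_inner_le_norm (vecMatrix (deltaMatrix x x')) (vecMatrix A)
  have h2 := abs_real_inner_le_norm (x - x') w
  rw [norm_vecMatrix A] at h1
  have h3 := mul_le_mul (norm_vecMatrix_deltaMatrix_le hx hx') hA (norm_nonneg _) zero_le_two
  have h4 := mul_le_mul (norm_sub_le_two hx hx') hw (norm_nonneg _) zero_le_two
  linarith

theorem trace_vecMulVec_transpose_mul {r : ℕ} (x : Fin r → ℝ) (A : Matrix (Fin r) (Fin r) ℝ) :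
    ((Matrix.vecMulVec x x)ᵀ * A).trace = x ⬝ᵥ (A *ᵥ x) := by
  rw [Matrix.transpose_vecMulVec, Matrix.vecMulVec_mul, Matrix.trace_vecMulVec,
    Matrix.dotProduct_mulVec, dotProduct_comm]

theorem mahalanobis_sq {r : ℕ} {M : Matrix (Fin r) (Fin r) ℝ} (hM : M.PosSemidef) (x x' : Item r) :
    mahalanobis M x x' ^ 2 = (x - x').ofLp ⬝ᵥ (M *ᵥ (x - x').ofLp) := by
  rw [mahalanobis, Real.sq_sqrt]
  simpa using hM.dotProduct_mulVec_nonneg (x - x').ofLp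

/-- The terms `uᵀ M u` cancel in the difference, and by symmetry of `M` the cross terms combine into
the pairing with `-2 M u`. -/
theorem psi_eq_measurement {r : ℕ} {M : Matrix (Fin r) (Fin r) ℝ} (hM : M.PosSemidef)
    (x x' u : Item r) : psi M x x' u = measurement x x' M (pseudoIdealPoint M u) := by
  have hsymm : ∀ a : Fin r → ℝ, u.ofLp ⬝ᵥ (M *ᵥ a) = a ⬝ᵥ (M *ᵥ u.ofLp) := by
    intro a
    have hT : Mᵀ = M := by
      rw [← Matrix.conjTranspose_eq_transpose_of_trivial]; exact hM.1.eq
    rw [Matrix.dotProduct_mulVec, ← Matrix.mulVec_transpose, hT, dotProduct_comm]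
  rw [psi, mahalanobis_sq hM, mahalanobis_sq hM, measurement, deltaMatrix, Matrix.transpose_sub,
    Matrix.sub_mul, Matrix.trace_sub, trace_vecMulVec_transpose_mul, trace_vecMulVec_transpose_mul]
  have hinner : inner ℝ (x - x') (pseudoIdealPoint M u) =
      -2 * (x.ofLp ⬝ᵥ (M *ᵥ u.ofLp) - x'.ofLp ⬝ᵥ (M *ᵥ u.ofLp)) := by
    rw [EuclideanSpace.inner_eq_star_dotProduct, pseudoIdealPoint, dotProduct_comm]
    simp [sub_dotProduct]
  rw [hinner]
  simp only [WithLp.ofLp_sub, Matrix.mulVec_sub, sub_dotProduct, dotProduct_sub, hsymm]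
  ring

theorem continuous_measurement {r : ℕ} (A : Matrix (Fin r) (Fin r) ℝ) (w : Item r) :
    Continuous fun q : Item r × Item r => measurement q.1 q.2 A w := by
  simp only [measurement, deltaMatrix, Matrix.transpose_sub, Matrix.sub_mul, Matrix.trace_sub,
    trace_vecMulVec_transpose_mul, dotProduct, Matrix.mulVec]
  fun_prop

theorem measurement_sub {r : ℕ} (x x' : Item r) (A A' : Matrix (Fin r) (Fin r) ℝ)
    (w w' : Item r) :
    measurement x x' (A - A') (w - w') = measurement x x' A w - measurement x x' A' w' := by
  simp only [measurement, Matrix.mul_sub, Matrix.trace_sub, inner_sub_right]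
  ring

/-- The space of all parameters: the entries of a matrix and one vector for each user. -/
abbrev JointParam (r K : ℕ) : Type :=
  WithLp 2 (EuclideanSpace ℝ (Fin r × Fin r) × PiLp 2 fun _ : Fin K => Item r)

/-- The vector representing the measurement of a pair of items by the user `k`. -/
def feature {r K : ℕ} (k : Fin K) (q : Item r × Item r) : JointParam r K :=
  WithLp.toLp 2 (vecMatrix (deltaMatrix q.1 q.2), PiLp.single 2 k (q.1 - q.2))

theorem inner_feature {r K : ℕ} (k : Fin K) (q : Item r × Item r) (θ : JointParam r K) :
    inner ℝ (feature k q) θ = measurement q.1 q.2 (unvecMatrix θ.fst) (θ.snd k) := by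
  rw [WithLp.prod_inner_apply, measurement, ← inner_vecMatrix, vecMatrix_unvecMatrix]
  congr 1
  simp only [feature, PiLp.inner_apply]
  rw [Finset.sum_eq_single k]
  · simp
  · intro j _ hj
    simp [hj]
  · simp

/-- The matrix block and the block of user `k` each have norm at most 2 and all other blocks vanish,
so the bound does not depend on `K`. -/
theorem norm_feature_le {r K : ℕ} (k : Fin K) {q : Item r × Item r} (h1 : ‖q.1‖ ≤ 1)
    (h2 : ‖q.2‖ ≤ 1) : ‖feature k q‖ ≤ √8 := by
  refine Real.le_sqrt_of_sq_le ?_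
  rw [WithLp.prod_norm_sq_eq_of_L2]
  have h3 := norm_vecMatrix_deltaMatrix_le h1 h2
  have h4 := norm_sub_le_two h1 h2
  change ‖vecMatrix (deltaMatrix q.1 q.2)‖ ^ 2 +
    ‖(PiLp.single 2 k (q.1 - q.2) : PiLp 2 fun _ : Fin K => Item r)‖ ^ 2 ≤ 8
  rw [PiLp.norm_single]
  nlinarith [norm_nonneg (vecMatrix (deltaMatrix q.1 q.2)), norm_nonneg (q.1 - q.2)]

/-- The feasible parameters of the estimator. -/
def feasibleSet (r K : ℕ) (ζM ζv : ℝ) : Set (JointParam r K) :=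
  {θ | IsFeasible ζM ζv (unvecMatrix θ.fst) fun k => θ.snd k}

theorem norm_le_of_mem_feasibleSet {r K : ℕ} {ζM ζv : ℝ} {θ : JointParam r K}
    (h : θ ∈ feasibleSet r K ζM ζv) : ‖θ‖ ≤ √(ζM ^ 2 + K * ζv ^ 2) := by
  refine Real.le_sqrt_of_sq_le ?_
  rw [WithLp.prod_norm_sq_eq_of_L2, PiLp.norm_sq_eq_of_L2 _ θ.snd]
  obtain ⟨-, h1, h2⟩ := h
  rw [norm_unvecMatrix] at h1
  refine add_le_add (pow_le_pow_left₀ (norm_nonneg _) h1 2) ?_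
  calc ∑ k, ‖θ.snd k‖ ^ 2 ≤ ∑ _ : Fin K, ζv ^ 2 :=
        Finset.sum_le_sum fun k _ => pow_le_pow_left₀ (norm_nonneg _) (h2 k) 2
    _ = K * ζv ^ 2 := by simp

theorem isCompact_feasibleSet (r K : ℕ) (ζM ζv : ℝ) : IsCompact (feasibleSet r K ζM ζv) := by
  refine Metric.isCompact_of_isClosed_isBounded ?_ ?_
  · simp only [feasibleSet, IsFeasible, Matrix.posSemidef_iff_dotProduct_mulVec, norm_unvecMatrix,
      Matrix.IsHermitian.ext_iff]
    have h1 : IsClosed {θ : JointParam r K | ∀ i j,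
        star (unvecMatrix θ.fst j i) = unvecMatrix θ.fst i j} := by
      simp only [Set.ofPred_forall, unvecMatrix, Matrix.of_apply, star_trivial]
      exact isClosed_iInter fun i => isClosed_iInter fun j =>
        isClosed_eq (by fun_prop) (by fun_prop)
    have h2 : IsClosed {θ : JointParam r K | ∀ x : Fin r → ℝ,
        0 ≤ star x ⬝ᵥ (unvecMatrix θ.fst *ᵥ x)} := by
      simp only [Set.ofPred_forall, unvecMatrix, dotProduct, Matrix.mulVec, Matrix.of_apply]
      exact isClosed_iInter fun i => isClosed_le (by fun_prop) (by fun_prop)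
    have h3 : IsClosed {θ : JointParam r K | ‖θ.fst‖ ≤ ζM} :=
      isClosed_le (by fun_prop) (by fun_prop)
    have h4 : IsClosed {θ : JointParam r K | ∀ k, ‖θ.snd k‖ ≤ ζv} := by
      simp only [Set.ofPred_forall]
      exact isClosed_iInter fun i => isClosed_le (by fun_prop) (by fun_prop)
    exact (h1.inter h2).inter (h3.inter h4)
  · refine (Metric.isBounded_closedBall (x := (0 : JointParam r K))
      (r := √(ζM ^ 2 + K * ζv ^ 2))).subset ?_
    exact fun θ hθ => mem_closedBall_zero_iff.mpr (norm_le_of_mem_feasibleSet hθ)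

/-! ### The least singular value -/

/-- The eigenbasis of `T* T` gives `σ ‖y‖ ≤ ‖T y‖`; evaluated at eigenvectors of `T`, whose
eigenvalues are nonnegative, this bounds every eigenvalue below by `σ`. -/
theorem _root_.LinearMap.IsPositive.singularValues_mul_norm_sq_le {E : Type*}
    [NormedAddCommGroup E] [InnerProductSpace ℝ E] [FiniteDimensional ℝ E] {T : E →ₗ[ℝ] E}
    (hT : T.IsPositive) (x : E) :
    T.singularValues (Module.finrank ℝ E - 1) * ‖x‖ ^ 2 ≤ inner ℝ (T x) x := by
  set n := Module.finrank ℝ E with hn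
  set σ := T.singularValues (n - 1) with hσ
  have hS := hT.isSymmetric
  have hcomp : ∀ y, σ ^ 2 * ‖y‖ ^ 2 ≤ ‖T y‖ ^ 2 := by
    intro y
    have hA := T.isSymmetric_adjoint_comp_self
    have h1 : ‖T y‖ ^ 2 = inner ℝ ((LinearMap.adjoint T ∘ₗ T) y) y := by
      rw [LinearMap.comp_apply, LinearMap.adjoint_inner_left, real_inner_self_eq_norm_sq]
    rw [h1, ← (hA.eigenvectorBasis hn.symm).repr.inner_map_map,
      ← (hA.eigenvectorBasis hn.symm).repr.norm_map y, EuclideanSpace.norm_sq_eq, PiLp.inner_apply,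
      Finset.mul_sum]
    refine Finset.sum_le_sum fun i _ => ?_
    rw [hA.eigenvectorBasis_apply_self_apply, ← T.sq_singularValues_fin hn.symm]
    have h2 : σ ^ 2 ≤ T.singularValues i ^ 2 :=
      pow_le_pow_left₀ (T.singularValues_nonneg _) (T.singularValues_antitone (by omega)) 2
    have h3 := mul_le_mul_of_nonneg_right h2
      (sq_nonneg ((hA.eigenvectorBasis hn.symm).repr y i))
    simp only [Real.norm_eq_abs, sq_abs, RCLike.inner_apply, conj_trivial, RCLike.ofReal_real_eq_id,
      id_eq]
    linarith
  have heig : ∀ i, σ ≤ hS.eigenvalues hn.symm i := by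
    intro i
    have h1 := hcomp (hS.eigenvectorBasis hn.symm i)
    rw [hS.apply_eigenvectorBasis, norm_smul, (hS.eigenvectorBasis hn.symm).norm_eq_one] at h1
    have h0 : 0 ≤ hS.eigenvalues hn.symm i := hT.nonneg_eigenvalues hn.symm i
    simp only [RCLike.ofReal_real_eq_id, id_eq, Real.norm_eq_abs, mul_one, one_pow, sq_abs] at h1
    exact le_of_sq_le_sq h1 h0
  rw [← (hS.eigenvectorBasis hn.symm).repr.inner_map_map,
    ← (hS.eigenvectorBasis hn.symm).repr.norm_map x, EuclideanSpace.norm_sq_eq, PiLp.inner_apply,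
    Finset.mul_sum]
  refine Finset.sum_le_sum fun i _ => ?_
  rw [hS.eigenvectorBasis_apply_self_apply]
  have h3 := mul_le_mul_of_nonneg_right (heig i)
    (sq_nonneg ((hS.eigenvectorBasis hn.symm).repr x i))
  simp only [Real.norm_eq_abs, sq_abs, RCLike.inner_apply, conj_trivial, RCLike.ofReal_real_eq_id,
      id_eq]
  linarith

theorem singularValues_integral_gram_mul_norm_sq_le {S E F : Type*} [MeasurableSpace S]
    [NormedAddCommGroup E] [InnerProductSpace ℝ E] [FiniteDimensional ℝ E] [CompleteSpace E]
    [NormedAddCommGroup F] [InnerProductSpace ℝ F] [CompleteSpace F] {P : Measure S}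
    {T : S → E →L[ℝ] F}
    (h : 0 < (∫ z, (ContinuousLinearMap.adjoint (T z)).comp (T z) ∂P).toLinearMap.singularValues
      (Module.finrank ℝ E - 1)) (x : E) :
    (∫ z, (ContinuousLinearMap.adjoint (T z)).comp (T z) ∂P).toLinearMap.singularValues
      (Module.finrank ℝ E - 1) * ‖x‖ ^ 2 ≤ ∫ z, ‖T z x‖ ^ 2 ∂P := by
  -- The integral of a non-integrable function is 0 by convention, and the zero map has no positive
  -- singular value.
  have hi : Integrable (fun z => (ContinuousLinearMap.adjoint (T z)).comp (T z)) P := by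
    by_contra hn
    rw [integral_undef hn] at h
    simp at h
  have hinner : ∀ x y, inner ℝ ((∫ z, (ContinuousLinearMap.adjoint (T z)).comp (T z) ∂P) x) y =
      ∫ z, inner ℝ (T z x) (T z y) ∂P := by
    intro x y
    rw [ContinuousLinearMap.integral_apply hi, real_inner_comm,
      ← integral_inner (hi.apply_continuousLinearMap x)]
    refine integral_congr_ae (ae_of_all _ fun z => ?_)
    beta_reduce
    rw [ContinuousLinearMap.comp_apply, ContinuousLinearMap.adjoint_inner_right, real_inner_comm]
  have hpos : (∫ z, (ContinuousLinearMap.adjoint (T z)).comp (T z) ∂P).toLinearMap.IsPositive := by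
    refine ⟨fun a b => ?_, fun a => ?_⟩
    · rw [real_inner_comm _ a]
      simp only [ContinuousLinearMap.coe_coe]
      rw [hinner, hinner]
      exact integral_congr_ae (ae_of_all _ fun z => real_inner_comm _ _)
    · simp only [ContinuousLinearMap.coe_coe]
      rw [hinner]
      exact integral_nonneg fun z => real_inner_self_nonneg
  refine (hpos.singularValues_mul_norm_sq_le x).trans (le_of_eq ?_)
  rw [ContinuousLinearMap.coe_coe, hinner]
  simp_rw [real_inner_self_eq_norm_sq]

theorem sigmaMinSq_mul_norm_sq_le {r m : ℕ} (hm : 0 < m) {P : Measure (ItemPairs r m)}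
    (hσ : 0 < sigmaMinSq P) {A : Matrix (Fin r) (Fin r) ℝ} (hA : A.IsHermitian) (w : Item r) :
    m * sigmaMinSq P * ‖A‖ ^ 2 ≤ ∫ z, ∑ i, measurement (z i).1 (z i).2 A w ^ 2 ∂P := by
  have hsym : vecMatrix A ∈ symSpace r := fun i j => hA.apply j i
  let θ : ParamSpace r := WithLp.toLp 2 (⟨vecMatrix A, hsym⟩, w)
  have hm' : (0 : ℝ) < m := by exact_mod_cast hm
  have hσ' : 0 < (expectedGram P).toLinearMap.singularValues
      (Module.finrank ℝ (ParamSpace r) - 1) :=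
    pos_of_mul_pos_right hσ (one_div_nonneg.mpr hm'.le)
  have h1 : (expectedGram P).toLinearMap.singularValues (Module.finrank ℝ (ParamSpace r) - 1) *
      ‖θ‖ ^ 2 ≤ ∫ z, ‖designMap z θ‖ ^ 2 ∂P :=
    singularValues_integral_gram_mul_norm_sq_le hσ' θ
  have h2 : ∀ z : ItemPairs r m, ‖designMap z θ‖ ^ 2 =
      ∑ i, measurement (z i).1 (z i).2 A w ^ 2 := by
    intro z
    rw [EuclideanSpace.norm_sq_eq]
    refine Finset.sum_congr rfl fun i _ => ?_
    rw [Real.norm_eq_abs, sq_abs]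
    rfl
  simp_rw [h2] at h1
  refine le_trans ?_ h1
  rw [sigmaMinSq, ← mul_assoc, mul_one_div_cancel hm'.ne', one_mul]
  refine mul_le_mul_of_nonneg_left ?_ hσ'.le
  rw [WithLp.prod_norm_sq_eq_of_L2, ← norm_vecMatrix]
  exact le_add_of_nonneg_right (sq_nonneg _)

/-! ### Binary relative entropy and link functions -/

/-- The squared Hellinger distance `H` lies between the two sides. This form of Pinsker's inequality
has a constant that is not optimal but suffices here. -/
theorem sq_sub_le_binary_relative_entropy {p q : ℝ} (hp0 : 0 < p) (hp1 : p < 1) (hq0 : 0 < q)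
    (hq1 : q < 1) :
    (p - q) ^ 2 ≤ p * (-Real.log q - -Real.log p) +
      (1 - p) * (-Real.log (1 - q) - -Real.log (1 - p)) := by
  -- This is `log t ≤ t - 1` at `t = √(b / a)`.
  have key : ∀ a b : ℝ, 0 < a → 0 < b → 2 * a - 2 * (√a * √b) ≤ a * (-Real.log b - -Real.log a) := by
    intro a b ha hb
    have ha' := Real.sqrt_pos.mpr ha
    have hb' := Real.sqrt_pos.mpr hb
    have h1 := Real.log_le_sub_one_of_pos (div_pos hb' ha')
    rw [Real.log_div hb'.ne' ha'.ne', Real.log_sqrt hb.le, Real.log_sqrt ha.le] at h1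
    have h2 := mul_le_mul_of_nonneg_left h1 ha.le
    have h3 : a * (√b / √a) = √a * √b := by
      nth_rw 1 [← Real.mul_self_sqrt ha.le]
      field_simp
    nlinarith
  have k1 := key p q hp0 hq0
  have k2 := key (1 - p) (1 - q) (by linarith) (by linarith)
  have s1 := Real.mul_self_sqrt hp0.le
  have s2 := Real.mul_self_sqrt hq0.le
  have s3 := Real.mul_self_sqrt (show 0 ≤ 1 - p by linarith)
  have s4 := Real.mul_self_sqrt (show 0 ≤ 1 - q by linarith)
  set a := √p
  set b := √q
  set c := √(1 - p)
  set d := √(1 - q)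
  -- The right side is `H`, and Cauchy–Schwarz gives `4 (p - q)² ≤ H (4 - H) ≤ 4 H`.
  have hle : (p - q) ^ 2 ≤ 2 - 2 * (a * b + c * d) := by
    have t3 : 2 - 2 * (a * b + c * d) = (a - b) ^ 2 + (d - c) ^ 2 := by linarith
    have t4 : (a + b) ^ 2 + (d + c) ^ 2 = 4 - ((a - b) ^ 2 + (d - c) ^ 2) := by linarith
    have t5 : 4 * (p - q) ^ 2 ≤ ((a - b) ^ 2 + (d - c) ^ 2) * ((a + b) ^ 2 + (d + c) ^ 2) := by
      have : 2 * (p - q) = (a - b) * (a + b) + (d - c) * (d + c) := by linarith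
      nlinarith [sq_nonneg ((a - b) * (d + c) - (d - c) * (a + b))]
    rw [t3]
    nlinarith [sq_nonneg ((a - b) ^ 2 + (d - c) ^ 2)]
  linarith

namespace IsLinkFunction

variable {f : ℝ → ℝ}

theorem pos (hf : IsLinkFunction f) (z : ℝ) : 0 < f z :=
  (hf.mem_Icc (z - 1)).1.trans_lt (hf.strictMono (by linarith))

theorem lt_one (hf : IsLinkFunction f) (z : ℝ) : f z < 1 :=
  (hf.strictMono (by linarith : z < z + 1)).trans_le (hf.mem_Icc (z + 1)).2

theorem neg (hf : IsLinkFunction f) (z : ℝ) : f (-z) = 1 - f z := by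
  have := hf.symm z
  linarith

theorem mul_abs_sub_le (hf : IsLinkFunction f) {B c : ℝ}
    (hd : ∀ z, |z| ≤ B → DifferentiableAt ℝ f z ∧ c ≤ deriv f z) {a b : ℝ} (ha : |a| ≤ B)
    (hb : |b| ≤ B) : c * |a - b| ≤ |f a - f b| := by
  wlog h : b ≤ a generalizing a b
  · rw [abs_sub_comm a, abs_sub_comm (f a)]
    exact this hb ha (le_of_not_ge h)
  rw [abs_of_nonneg (sub_nonneg.mpr h), abs_of_nonneg (sub_nonneg.mpr (hf.strictMono.monotone h))]
  have hmem : ∀ z ∈ Set.Icc (-B) B, |z| ≤ B := fun z hz => abs_le.mpr hz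
  refine (convex_Icc (-B) B).mul_sub_le_image_sub_of_le_deriv
    (fun z hz => (hd z (hmem z hz)).1.continuousAt.continuousWithinAt)
    (fun z hz => (hd z (hmem z (interior_subset hz))).1.differentiableWithinAt)
    (fun z hz => (hd z (hmem z (interior_subset hz))).2) b (abs_le.mp hb) a (abs_le.mp ha) h

theorem sq_sub_le_expected_loss (hf : IsLinkFunction f) {B c : ℝ} (hc : 0 ≤ c)
    (hd : ∀ z, |z| ≤ B → DifferentiableAt ℝ f z ∧ c ≤ deriv f z) {a b : ℝ} (ha : |a| ≤ B)
    (hb : |b| ≤ B) : c ^ 2 * (a - b) ^ 2 ≤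
      f b * (-Real.log (f a) - -Real.log (f b)) +
        f (-b) * (-Real.log (f (-a)) - -Real.log (f (-b))) := by
  rw [hf.neg a, hf.neg b]
  refine le_trans ?_ (sq_sub_le_binary_relative_entropy (hf.pos b) (hf.lt_one b) (hf.pos a)
    (hf.lt_one a))
  rw [← mul_pow, ← sq_abs (f b - f a), abs_sub_comm, ← sq_abs (c * (a - b)), abs_mul,
    abs_of_nonneg hc]
  exact pow_le_pow_left₀ (by positivity) (hf.mul_abs_sub_le hd ha hb) 2

theorem measurable_loss (hf : IsLinkFunction f) : Measurable fun z => -Real.log (f z) :=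
  (Real.measurable_log.comp hf.strictMono.monotone.measurable).neg

/-- The loss is strictly decreasing, hence not constant. Positivity is needed because the Chernoff
parameter has `L` in its denominator. -/
theorem lipschitz_constant_pos (hf : IsLinkFunction f) {B : ℝ} (hB : 0 < B) {L : ℝ≥0}
    (hL : LipschitzOnWith L (fun z => -Real.log (f z)) {z : ℝ | |z| ≤ B}) : 0 < L := by
  rw [pos_iff_ne_zero]
  rintro rfl
  have h := hL.dist_le_mul 0 (by simpa using hB.le) B (by simp [abs_of_pos hB])
  have h1 := Real.log_lt_log (hf.pos 0) (hf.strictMono hB)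
  rw [NNReal.coe_zero, zero_mul, Real.dist_eq] at h
  have h2 := abs_nonpos_iff.mp h
  linarith

end IsLinkFunction

/-! ### Uniform deviation of the empirical risk -/

/-- The difference of the losses of `θ` and `θ₀` on one response of the user `k`. -/
def lossDiff {r K : ℕ} (loss : ℝ → ℝ) (θ₀ θ : JointParam r K) (k : Fin K)
    (s : (Item r × Item r) × ℝ) : ℝ :=
  loss (s.2 * inner ℝ (feature k s.1) θ) - loss (s.2 * inner ℝ (feature k s.1) θ₀)

/-- The items of the observation lie in the unit ball, and the response is a sign. -/
def IsRegular {r : ℕ} (s : (Item r × Item r) × ℝ) : Prop :=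
  (‖s.1.1‖ ≤ 1 ∧ ‖s.1.2‖ ≤ 1) ∧ (s.2 = 1 ∨ s.2 = -1)

theorem measurable_inner_feature {r K : ℕ} (k : Fin K) (θ : JointParam r K) :
    Measurable fun q : Item r × Item r => inner ℝ (feature k q) θ := by
  simp_rw [inner_feature]
  exact (continuous_measurement _ _).measurable

theorem measurable_lossDiff {r K : ℕ} {loss : ℝ → ℝ} (hl : Measurable loss)
    (θ₀ θ : JointParam r K) (k : Fin K) : Measurable (lossDiff loss θ₀ θ k) :=
  (hl.comp (measurable_snd.mul ((measurable_inner_feature k θ).comp measurable_fst))).sub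
    (hl.comp (measurable_snd.mul ((measurable_inner_feature k θ₀).comp measurable_fst)))

theorem IsRegular.abs_mul {r : ℕ} {s : (Item r × Item r) × ℝ} (hs : IsRegular s) (a : ℝ) :
    |s.2 * a| = |a| := by
  rcases hs.2 with h | h <;> simp [h]

theorem abs_inner_feature_le {r K : ℕ} {ζM ζv : ℝ} {θ : JointParam r K}
    (hθ : θ ∈ feasibleSet r K ζM ζv) (k : Fin K) {q : Item r × Item r} (h1 : ‖q.1‖ ≤ 1)
    (h2 : ‖q.2‖ ≤ 1) : |inner ℝ (feature k q) θ| ≤ 2 * (ζM + ζv) := by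
  rw [inner_feature]
  exact abs_measurement_le h1 h2 hθ.2.1 (hθ.2.2 k)

section Deviation

variable {r K : ℕ} {ζM ζv : ℝ} {loss : ℝ → ℝ} {L : ℝ≥0}

theorem IsRegular.abs_loss_sub_le
    (hL : LipschitzOnWith L loss {z : ℝ | |z| ≤ 2 * (ζM + ζv)}) {s : (Item r × Item r) × ℝ}
    (hs : IsRegular s) (k : Fin K) {θ θ' : JointParam r K} (hθ : θ ∈ feasibleSet r K ζM ζv)
    (hθ' : θ' ∈ feasibleSet r K ζM ζv) :
    |loss (s.2 * inner ℝ (feature k s.1) θ) - loss (s.2 * inner ℝ (feature k s.1) θ')| ≤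
      L * |inner ℝ (feature k s.1) θ - inner ℝ (feature k s.1) θ'| := by
  have hmem : ∀ θ ∈ feasibleSet r K ζM ζv,
      s.2 * inner ℝ (feature k s.1) θ ∈ {z : ℝ | |z| ≤ 2 * (ζM + ζv)} := fun θ hθ => by
    change |s.2 * inner ℝ (feature k s.1) θ| ≤ _
    rw [hs.abs_mul]
    exact abs_inner_feature_le hθ k hs.1.1 hs.1.2
  have h := hL.dist_le_mul _ (hmem θ hθ) _ (hmem θ' hθ')
  rwa [Real.dist_eq, Real.dist_eq, ← mul_sub, hs.abs_mul] at h

theorem IsRegular.abs_lossDiff_le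
    (hL : LipschitzOnWith L loss {z : ℝ | |z| ≤ 2 * (ζM + ζv)}) {s : (Item r × Item r) × ℝ}
    (hs : IsRegular s) (k : Fin K) {θ₀ θ : JointParam r K} (hθ₀ : θ₀ ∈ feasibleSet r K ζM ζv)
    (hθ : θ ∈ feasibleSet r K ζM ζv) :
    |lossDiff loss θ₀ θ k s| ≤ L * |inner ℝ (feature k s.1) (θ - θ₀)| := by
  rw [inner_sub_right]
  exact hs.abs_loss_sub_le hL k hθ hθ₀

theorem IsRegular.abs_lossDiff_sub_le
    (hL : LipschitzOnWith L loss {z : ℝ | |z| ≤ 2 * (ζM + ζv)}) {s : (Item r × Item r) × ℝ}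
    (hs : IsRegular s) (k : Fin K) (θ₀ : JointParam r K) {θ θ' : JointParam r K}
    (hθ : θ ∈ feasibleSet r K ζM ζv) (hθ' : θ' ∈ feasibleSet r K ζM ζv) :
    |lossDiff loss θ₀ θ k s - lossDiff loss θ₀ θ' k s| ≤
      L * |inner ℝ (feature k s.1) θ - inner ℝ (feature k s.1) θ'| := by
  rw [lossDiff, lossDiff, sub_sub_sub_cancel_right]
  exact hs.abs_loss_sub_le hL k hθ hθ'

variable {Ω : Type*} [MeasurableSpace Ω] {μ : Measure Ω} [IsProbabilityMeasure μ]

theorem integrable_lossDiff (hl : Measurable loss)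
    (hL : LipschitzOnWith L loss {z : ℝ | |z| ≤ 2 * (ζM + ζv)})
    {ν : Measure ((Item r × Item r) × ℝ)} [IsFiniteMeasure ν] (hν : ∀ᵐ s ∂ν, IsRegular s)
    {θ₀ θ : JointParam r K} (hθ₀ : θ₀ ∈ feasibleSet r K ζM ζv)
    (hθ : θ ∈ feasibleSet r K ζM ζv) (k : Fin K) : Integrable (lossDiff loss θ₀ θ k) ν := by
  refine Integrable.of_bound (measurable_lossDiff hl θ₀ θ k).aestronglyMeasurable
    (L * (√8 * ‖θ - θ₀‖)) ?_
  filter_upwards [hν] with s hs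
  refine (hs.abs_lossDiff_le hL k hθ₀ hθ).trans (mul_le_mul_of_nonneg_left ?_ L.2)
  exact (abs_real_inner_le_norm _ _).trans
    (mul_le_mul_of_nonneg_right (norm_feature_le k hs.1.1 hs.1.2) (norm_nonneg _))

variable {κ : Type*} [Fintype κ] {ξ : κ → Ω → (Item r × Item r) × ℝ}

/-- The deviation of the empirical excess risk from its expectation. -/
def deviation (μ : Measure Ω) (ξ : κ → Ω → (Item r × Item r) × ℝ) (user : κ → Fin K)
    (loss : ℝ → ℝ) (θ₀ θ : JointParam r K) (ω : Ω) : ℝ :=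
  ∑ i, (∫ s, lossDiff loss θ₀ θ (user i) s ∂(μ.map (ξ i)) - lossDiff loss θ₀ θ (user i) (ξ i ω))

theorem lintegral_expSup_deviation_le (hξ : ∀ i, Measurable (ξ i)) (hind : iIndepFun ξ μ)
    (hreg : ∀ i, ∀ᵐ s ∂(μ.map (ξ i)), IsRegular s) (user : κ → Fin K) (hl : Measurable loss)
    (hL : LipschitzOnWith L loss {z : ℝ | |z| ≤ 2 * (ζM + ζv)}) {θ₀ : JointParam r K}
    (hθ₀ : θ₀ ∈ feasibleSet r K ζM ζv) {e : ℕ → JointParam r K}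
    (he : ∀ n, e n ∈ feasibleSet r K ζM ζv) {c : ℝ} (hc : 0 ≤ c) :
    ∫⁻ ω, expSup (fun n => c * deviation μ ξ user loss θ₀ (e n) ω) ∂μ ≤
      ENNReal.ofReal (2 * Real.exp (Fintype.card κ *
        (64 * (c * L * √(ζM ^ 2 + K * ζv ^ 2)) ^ 2))) := by
  set R := √(ζM ^ 2 + K * ζv ^ 2)
  have hcL : 0 ≤ c * L := mul_nonneg hc L.2
  have hprob : ∀ i, IsProbabilityMeasure (μ.map (ξ i)) :=
    fun i => Measure.isProbabilityMeasure_map (hξ i).aemeasurable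
  have key := lintegral_expSup_empirical_le hξ hind
    (fun i n s => c * lossDiff loss θ₀ (e n) (user i) s)
    (fun i n => (measurable_lossDiff hl θ₀ (e n) (user i)).const_mul c)
    (fun i n => (integrable_lossDiff hl hL (hreg i) hθ₀ (he n) (user i)).const_mul c)
    (fun i s => (c * L) • feature (user i) s.1) (fun n => e n - θ₀)
    (fun i n => by
      simp only [inner_smul_left]
      exact ((measurable_inner_feature (user i) _).comp measurable_fst).const_mul _)
    -- Parameters are centred at `θ₀`, so that the loss difference vanishes with the linear
    -- functional; a difference of two points of the ball of radius `R` has norm at most `2 R`.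
    (ρ := 2 * R) (b := c * L * √8)
    (fun n => (norm_sub_le _ _).trans (by
      linarith [norm_le_of_mem_feasibleSet (he n), norm_le_of_mem_feasibleSet hθ₀]))
    (fun i => by
      filter_upwards [hreg i] with s hs
      rw [norm_smul, Real.norm_of_nonneg hcL]
      exact mul_le_mul_of_nonneg_left (norm_feature_le _ hs.1.1 hs.1.2) hcL)
    (fun i => by
      filter_upwards [hreg i] with s hs n
      rw [inner_smul_left, conj_trivial, abs_mul, abs_mul, abs_of_nonneg hc, abs_of_nonneg hcL,
        mul_assoc]
      exact mul_le_mul_of_nonneg_left (hs.abs_lossDiff_le hL _ hθ₀ (he n)) hc)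
    (fun i => by
      filter_upwards [hreg i] with s hs n n'
      rw [inner_smul_left, inner_smul_left, conj_trivial, ← mul_sub, ← mul_sub, ← inner_sub_right,
        sub_sub_sub_cancel_right, inner_sub_right, abs_mul, abs_mul, abs_of_nonneg hc,
        abs_of_nonneg hcL, mul_assoc]
      exact mul_le_mul_of_nonneg_left (hs.abs_lossDiff_sub_le hL _ θ₀ (he n) (he n')) hc)
    Finset.univ 0
  refine le_trans (le_of_eq ?_) (key.trans (ENNReal.ofReal_le_ofReal ?_))
  · refine lintegral_congr fun ω => ?_
    congr 1
    ext n
    rw [inner_zero_left, zero_add, deviation, Finset.mul_sum]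
    refine Finset.sum_congr rfl fun i _ => ?_
    rw [integral_const_mul, mul_sub]
  · rw [norm_zero, mul_zero, Real.cosh_zero, one_mul, Finset.card_univ, Real.exp_nat_mul]
    refine mul_le_mul_of_nonneg_left (pow_le_pow_left₀ (Real.cosh_pos _).le
      ((Real.cosh_le_exp_half_sq _).trans (le_of_eq ?_)) _) zero_le_two
    congr 1
    have h8 : √(8 : ℝ) ^ 2 = 8 := Real.sq_sqrt (by norm_num)
    calc (2 * (2 * R) * (c * L * √8)) ^ 2 / 2 = 8 * (c * L * R) ^ 2 * √8 ^ 2 := by ring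
      _ = _ := by rw [h8]; ring

/-- Chernoff's method for the supremum; restricting to a sequence of parameters keeps the supremum
measurable. -/
theorem exists_measurableSet_deviation_le [Nonempty κ] (hξ : ∀ i, Measurable (ξ i))
    (hind : iIndepFun ξ μ) (hreg : ∀ i, ∀ᵐ s ∂(μ.map (ξ i)), IsRegular s) (user : κ → Fin K)
    (hl : Measurable loss) (hL : LipschitzOnWith L loss {z : ℝ | |z| ≤ 2 * (ζM + ζv)})
    (hL0 : 0 < L) (hζM : 0 < ζM) {θ₀ : JointParam r K}
    (hθ₀ : θ₀ ∈ feasibleSet r K ζM ζv) {e : ℕ → JointParam r K}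
    (he : ∀ n, e n ∈ feasibleSet r K ζM ζv) {p : ℝ} (hp : 0 < p) (hp1 : p ≤ 1) :
    ∃ E : Set Ω, MeasurableSet E ∧ ENNReal.ofReal (1 - p) ≤ μ E ∧ ∀ ω ∈ E, ∀ n,
      deviation μ ξ user loss θ₀ (e n) ω ≤
        16 * L * √((ζM ^ 2 + K * ζv ^ 2) * Real.log (4 / p) * Fintype.card κ) := by
  set N : ℝ := (Fintype.card κ : ℝ) with hN
  set Λ := Real.log (4 / p) with hΛ
  have hN0 : 0 < N := Nat.cast_pos.mpr Fintype.card_pos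
  have hΛ0 : 0 < Λ := Real.log_pos (by rw [lt_div_iff₀ hp]; linarith)
  have hR2 : 0 < ζM ^ 2 + K * ζv ^ 2 := by positivity
  set R := √(ζM ^ 2 + K * ζv ^ 2) with hR
  have hR0 : 0 < R := Real.sqrt_pos.mpr hR2
  have hL' : (0 : ℝ) < L := hL0
  have hsN := Real.sqrt_pos.mpr hN0
  have hsΛ := Real.sqrt_pos.mpr hΛ0
  rw [Real.sqrt_mul (by positivity), Real.sqrt_mul hR2.le, ← hR]
  -- This choice makes the exponent `64 N (c L R)²` equal to `Λ` and `c` times the threshold equal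
  -- to `2 Λ`, so Markov's inequality leaves `2 exp (-Λ) = p / 2`.
  set c : ℝ := √Λ / (8 * √N * L * R) with hc
  have hc0 : 0 < c := by positivity
  have hcT : c * (16 * L * (R * √Λ * √N)) = 2 * Λ := by
    rw [hc]
    field_simp
    rw [Real.sq_sqrt hΛ0.le]
    ring
  have hexp : N * (64 * (c * L * R) ^ 2) = Λ := by
    have : c * L * R = √Λ / (8 * √N) := by rw [hc]; field_simp
    rw [this, div_pow, mul_pow, Real.sq_sqrt hΛ0.le, Real.sq_sqrt hN0.le]
    field_simp
    ring
  let Φ : Ω → ℝ≥0∞ := fun ω => expSup (fun n => c * deviation μ ξ user loss θ₀ (e n) ω)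
  have hΦm : Measurable Φ := measurable_expSup fun n =>
    (Finset.measurable_sum _ fun i _ =>
      ((measurable_lossDiff hl θ₀ (e n) (user i)).comp (hξ i)).const_sub _).const_mul c
  have hΦ : ∫⁻ ω, Φ ω ∂μ ≤ ENNReal.ofReal (2 * Real.exp Λ) := by
    have := lintegral_expSup_deviation_le hξ hind hreg user hl hL hθ₀ he hc0.le
    rwa [← hN, hexp] at this
  let t := ENNReal.ofReal (Real.exp (2 * Λ))
  have ht0 : t ≠ 0 := by simp [t, Real.exp_pos]
  have htail : μ {ω | t ≤ Φ ω} ≤ ENNReal.ofReal p := by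
    refine (meas_ge_le_lintegral_div hΦm.aemeasurable ht0 ENNReal.ofReal_ne_top).trans ?_
    refine (ENNReal.div_le_div_right hΦ _).trans ?_
    rw [← ENNReal.ofReal_div_of_pos (Real.exp_pos _)]
    refine ENNReal.ofReal_le_ofReal ?_
    have hexpΛ : Real.exp Λ = 4 / p := Real.exp_log (by positivity)
    rw [two_mul Λ, Real.exp_add, hexpΛ]
    have : 2 * (4 / p) / (4 / p * (4 / p)) = p / 2 := by field_simp; norm_num
    rw [this]
    linarith
  refine ⟨{ω | t ≤ Φ ω}ᶜ, (measurableSet_le measurable_const hΦm).compl, ?_, fun ω hω n => ?_⟩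
  · rw [prob_compl_eq_one_sub (measurableSet_le measurable_const hΦm), ENNReal.ofReal_sub _ hp.le,
      ENNReal.ofReal_one]
    exact tsub_le_tsub_left htail 1
  · have h1 : Φ ω < t := not_le.mp hω
    have h2 := (le_expSup (fun n => c * deviation μ ξ user loss θ₀ (e n) ω) n).trans_lt h1
    have h3 := Real.exp_lt_exp.mp ((ENNReal.ofReal_lt_ofReal_iff (Real.exp_pos _)).mp h2)
    rw [← hcT] at h3
    exact (lt_of_mul_lt_mul_left h3 hc0.le).le

end Deviation

/-! ### The sampling model -/

section Model

variable {r m K : ℕ} {Ω : Type*} [MeasurableSpace Ω] {μ : Measure Ω} {f : ℝ → ℝ}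
  {Q : Matrix (Fin r) (Fin r) ℝ} {u : Fin K → Item r} {P : Measure (ItemPairs r m)}
  {D : Fin K → Ω → ItemPairs r m} {Y : Fin K → Fin m → Ω → ℝ}

theorem _root_.ProbabilityTheory.iIndepFun.comp_of_map {ι S S' Ω : Type*} [MeasurableSpace S]
    [MeasurableSpace S'] [MeasurableSpace Ω] {μ : Measure Ω} {X : Ω → S} (hX : Measurable X)
    {g : ι → S → S'} (hg : ∀ i, Measurable (g i)) (h : iIndepFun g (μ.map X)) :
    iIndepFun (fun i ω => g i (X ω)) μ := by
  rw [iIndepFun_iff_measure_inter_preimage_eq_mul] at h ⊢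
  intro s sets hs
  have := h s hs
  rw [Measure.map_apply hX (s.measurableSet_biInter fun i hi => hg i (hs i hi))] at this
  simp only [Set.preimage_iInter] at this
  rw [Finset.prod_congr rfl fun i hi => Measure.map_apply hX (hg i (hs i hi))] at this
  exact this

/-- The parameter consisting of the metric and the pseudo-ideal points of the users. -/
def trueParam (Q : Matrix (Fin r) (Fin r) ℝ) (u : Fin K → Item r) : JointParam r K :=
  WithLp.toLp 2 (vecMatrix Q, WithLp.toLp 2 fun k => pseudoIdealPoint Q (u k))

theorem inner_feature_trueParam (hQ : Q.PosSemidef) (k : Fin K) (q : Item r × Item r) :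
    inner ℝ (feature k q) (trueParam Q u) = psi Q q.1 q.2 (u k) := by
  rw [inner_feature, psi_eq_measurement hQ]
  rfl

namespace IsResponseModel

/-- Independence across users and independence of the pairs within a design combine into
independence of all `K m` item pairs. -/
theorem isSignModel (h : IsResponseModel μ f Q u P D Y) (hf : IsLinkFunction f)
    (hQ : Q.PosSemidef)
    (hP : iIndepFun (fun (i : Fin m) (z : ItemPairs r m) => z i) P) :
    IsSignModel μ (fun (q : Fin K × Fin m) ω => D q.1 ω q.2) (fun q => Y q.1 q.2)
      (fun q a c => f (c * inner ℝ (feature q.1 a) (trueParam Q u))) where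
  measurable_covariate q := (measurable_pi_apply q.2).comp (h.measurable_design q.1)
  indep_covariate := by
    refine iIndepFun_uncurry' (X := fun k i ω => D k ω i)
      (fun k i => (measurable_pi_apply i).comp (h.measurable_design k)) h.indep_design fun k => ?_
    rw [← h.law_design k] at hP
    exact hP.comp_of_map (h.measurable_design k) fun i => measurable_pi_apply i
  measurable_sign q := h.measurable_response q.1 q.2
  sign q ω := h.response_sign q.1 q.2 ω
  measurable_prob q c := hf.strictMono.monotone.measurable.comp
    ((measurable_inner_feature q.1 _).const_mul c)
  prob_nonneg q a c := (hf.mem_Icc _).1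
  prob_add q a := by
    rw [one_mul, neg_one_mul, hf.neg]
    ring
  law B hB c hc := by
    have hB' : MeasurableSet {z : Fin K → ItemPairs r m | ∀ q : Fin K × Fin m, z q.1 q.2 ∈ B q} :=
      measurableSet_forall_mem (x := fun (q : Fin K × Fin m) (z : Fin K → ItemPairs r m) =>
        z q.1 q.2) (fun q => (measurable_pi_apply q.2).comp (measurable_pi_apply q.1)) hB
    have := h.response_law _ hB' (fun k i => c (k, i)) fun k i => hc (k, i)
    simp only [inner_feature_trueParam hQ, Fintype.prod_prod_type]
    simpa only [Set.mem_ofPred_eq, Prod.forall] using this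

end IsResponseModel

variable {ζM ζv : ℝ}

/-- The observations of all the users. -/
def observation (D : Fin K → Ω → ItemPairs r m) (Y : Fin K → Fin m → Ω → ℝ)
    (q : Fin K × Fin m) (ω : Ω) : (Item r × Item r) × ℝ :=
  (D q.1 ω q.2, Y q.1 q.2 ω)

theorem IsResponseModel.measurable_observation (h : IsResponseModel μ f Q u P D Y)
    (q : Fin K × Fin m) : Measurable (observation D Y q) :=
  ((measurable_pi_apply q.2).comp (h.measurable_design q.1)).prodMk
    (h.measurable_response q.1 q.2)

theorem IsResponseModel.ae_norm_le (h : IsResponseModel μ f Q u P D Y)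
    (hP : ∀ᵐ z ∂P, ∀ i, ‖(z i).1‖ ≤ 1 ∧ ‖(z i).2‖ ≤ 1) :
    ∀ᵐ ω ∂μ, ∀ k i, ‖(D k ω i).1‖ ≤ 1 ∧ ‖(D k ω i).2‖ ≤ 1 := by
  rw [ae_all_iff]
  intro k
  rw [← h.law_design k] at hP
  exact ae_of_ae_map (h.measurable_design k).aemeasurable hP

theorem measurableSet_norm_le : MeasurableSet {q : Item r × Item r | ‖q.1‖ ≤ 1 ∧ ‖q.2‖ ≤ 1} :=
  (measurableSet_le measurable_fst.norm measurable_const).inter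
    (measurableSet_le measurable_snd.norm measurable_const)

theorem IsResponseModel.ae_isRegular (h : IsResponseModel μ f Q u P D Y)
    (hP : ∀ᵐ z ∂P, ∀ i, ‖(z i).1‖ ≤ 1 ∧ ‖(z i).2‖ ≤ 1) (q : Fin K × Fin m) :
    ∀ᵐ s ∂(μ.map (observation D Y q)), IsRegular s := by
  have hm : MeasurableSet {s : (Item r × Item r) × ℝ | IsRegular s} :=
    (measurable_fst measurableSet_norm_le).inter
      ((measurable_snd (measurableSet_singleton 1)).union
        (measurable_snd (measurableSet_singleton (-1))))
  rw [ae_map_iff (h.measurable_observation q).aemeasurable hm]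
  filter_upwards [h.ae_norm_le hP] with ω hω
  exact ⟨hω q.1 q.2, h.response_sign q.1 q.2 ω⟩

/-- Averaging over the response turns each summand into a relative entropy. The pairs of one user
are then reassembled into a full design, to which the singular value bound applies. -/
theorem IsResponseModel.le_expected_lossDiff [IsProbabilityMeasure μ]
    [IsProbabilityMeasure P] (h : IsResponseModel μ f Q u P D Y)
    (hf : IsLinkFunction f) (hm : 0 < m) (hQ : Q.PosSemidef) {cf : ℝ} (hcf : 0 ≤ cf) {L : ℝ≥0}
    (hd : ∀ z, |z| ≤ 2 * (ζM + ζv) → DifferentiableAt ℝ f z ∧ cf ≤ deriv f z)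
    (hL : LipschitzOnWith L (fun z => -Real.log (f z)) {z : ℝ | |z| ≤ 2 * (ζM + ζv)})
    (hP : iIndepFun (fun (i : Fin m) (z : ItemPairs r m) => z i) P)
    (hPball : ∀ᵐ z ∂P, ∀ i, ‖(z i).1‖ ≤ 1 ∧ ‖(z i).2‖ ≤ 1) (hσ : 0 < sigmaMinSq P)
    (hQu : trueParam Q u ∈ feasibleSet r K ζM ζv) {θ : JointParam r K}
    (hθ : θ ∈ feasibleSet r K ζM ζv) :
    cf ^ 2 * (m * K * sigmaMinSq P) * ‖θ.fst - vecMatrix Q‖ ^ 2 ≤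
      ∑ q : Fin K × Fin m, ∫ s, lossDiff (fun z => -Real.log (f z)) (trueParam Q u) θ q.1 s
        ∂(μ.map (observation D Y q)) := by
  have hS := h.isSignModel hf hQ hP
  have hmx : ∀ q : Fin K × Fin m, Measurable fun ω => D q.1 ω q.2 := hS.measurable_covariate
  set meas : Fin K → Item r × Item r → ℝ := fun k a =>
    measurement a.1 a.2 (unvecMatrix θ.fst - Q) (θ.snd k - pseudoIdealPoint Q (u k)) with hmeas
  have hmeq : ∀ k a, meas k a =
      inner ℝ (feature k a) θ - inner ℝ (feature k a) (trueParam Q u) := by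
    intro k a
    simp only [hmeas]
    rw [measurement_sub, inner_feature, inner_feature]
    rfl
  have hmm : ∀ k, Measurable (meas k) := fun k => (continuous_measurement _ _).measurable
  have hball : ∀ q : Fin K × Fin m, ∀ᵐ a ∂(μ.map fun ω => D q.1 ω q.2),
      ‖a.1‖ ≤ 1 ∧ ‖a.2‖ ≤ 1 := by
    intro q
    rw [ae_map_iff (hmx q).aemeasurable measurableSet_norm_le]
    filter_upwards [h.ae_norm_le hPball] with ω hω using hω q.1 q.2
  have hbound : ∀ k (a : Item r × Item r), ‖a.1‖ ≤ 1 ∧ ‖a.2‖ ≤ 1 →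
      ‖meas k a ^ 2‖ ≤ (4 * (ζM + ζv)) ^ 2 := by
    intro k a ha
    rw [Real.norm_eq_abs, abs_pow, hmeq]
    refine pow_le_pow_left₀ (abs_nonneg _) ((abs_sub _ _).trans ?_) 2
    linarith [abs_inner_feature_le hθ k ha.1 ha.2, abs_inner_feature_le hQu k ha.1 ha.2]
  have hterm : ∀ q : Fin K × Fin m, cf ^ 2 * ∫ z, meas q.1 (z q.2) ^ 2 ∂P ≤
      ∫ s, lossDiff (fun z => -Real.log (f z)) (trueParam Q u) θ q.1 s
        ∂(μ.map (observation D Y q)) := by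
    intro q
    have hprob : IsProbabilityMeasure (μ.map (observation D Y q)) :=
      Measure.isProbabilityMeasure_map (h.measurable_observation q).aemeasurable
    have hprob' : IsProbabilityMeasure (μ.map fun ω => D q.1 ω q.2) :=
      Measure.isProbabilityMeasure_map (hmx q).aemeasurable
    obtain ⟨hi, heq⟩ := hS.integral_prodMk q
      (measurable_lossDiff hf.measurable_loss (trueParam Q u) θ q.1)
      (integrable_lossDiff hf.measurable_loss hL (h.ae_isRegular hPball q) hQu hθ q.1)
    have hlaw : μ.map (fun ω => D q.1 ω q.2) = P.map fun z => z q.2 := by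
      rw [← h.law_design q.1, Measure.map_map (measurable_pi_apply _) (h.measurable_design _)]
      rfl
    have hsq : ∫ z, meas q.1 (z q.2) ^ 2 ∂P = ∫ a, meas q.1 a ^ 2 ∂(μ.map fun ω => D q.1 ω q.2) := by
      rw [hlaw, integral_map (measurable_pi_apply _).aemeasurable
        ((hmm q.1).pow_const 2).aestronglyMeasurable]
    change _ ≤ ∫ s, lossDiff (fun z => -Real.log (f z)) (trueParam Q u) θ q.1 s
        ∂(μ.map fun ω => (D q.1 ω q.2, Y q.1 q.2 ω))
    rw [heq, hsq, ← integral_const_mul]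
    refine integral_mono_ae ?_ hi ?_
    · refine Integrable.const_mul (Integrable.of_bound
        ((hmm q.1).pow_const 2).aestronglyMeasurable ((4 * (ζM + ζv)) ^ 2) ?_) _
      filter_upwards [hball q] with a ha using hbound q.1 a ha
    · filter_upwards [hball q] with a ha
      rw [hmeq]
      have := hf.sq_sub_le_expected_loss hcf hd (abs_inner_feature_le hθ q.1 ha.1 ha.2)
        (abs_inner_feature_le hQu q.1 ha.1 ha.2)
      simpa only [lossDiff, one_mul, neg_one_mul] using this
  refine le_trans ?_ (Finset.sum_le_sum fun q _ => hterm q)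
  rw [Fintype.sum_prod_type]
  have huser : ∀ k : Fin K, cf ^ 2 * (m * sigmaMinSq P * ‖θ.fst - vecMatrix Q‖ ^ 2) ≤
      ∑ i, cf ^ 2 * ∫ z, meas k (z i) ^ 2 ∂P := by
    intro k
    rw [← Finset.mul_sum, ← integral_finsetSum]
    · refine mul_le_mul_of_nonneg_left ?_ (sq_nonneg cf)
      have := sigmaMinSq_mul_norm_sq_le hm hσ (hθ.1.isHermitian.sub hQ.isHermitian)
        (θ.snd k - pseudoIdealPoint Q (u k))
      rwa [← norm_vecMatrix, vecMatrix_sub, vecMatrix_unvecMatrix] at this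
    · intro i _
      refine Integrable.of_bound
        (((hmm k).comp (measurable_pi_apply i)).pow_const 2).aestronglyMeasurable
        ((4 * (ζM + ζv)) ^ 2) ?_
      filter_upwards [hPball] with z hz using hbound k (z i) (hz i)
  refine le_trans (le_of_eq ?_) (Finset.sum_le_sum fun k _ => huser k)
  rw [Finset.sum_const, Finset.card_univ, Fintype.card_fin, nsmul_eq_mul]
  ring

end Model

/-! ### The empirical risk -/

section Risk

variable {r m K : ℕ} {ζM ζv : ℝ} {loss : ℝ → ℝ} {z : Fin K → ItemPairs r m} {y : Fin K → Fin m → ℝ}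

/-- The empirical risk of a parameter. -/
def risk (loss : ℝ → ℝ) (z : Fin K → ItemPairs r m) (y : Fin K → Fin m → ℝ)
    (θ : JointParam r K) : ℝ :=
  empiricalRisk loss z y (unvecMatrix θ.fst) fun k => θ.snd k

theorem risk_eq_sum (θ : JointParam r K) :
    risk loss z y θ = ∑ q : Fin K × Fin m, loss (y q.1 q.2 * inner ℝ (feature q.1 (z q.1 q.2)) θ) := by
  rw [Fintype.sum_prod_type]
  simp only [inner_feature]
  rfl

theorem continuousOn_risk {L : ℝ≥0} (hL : LipschitzOnWith L loss {z : ℝ | |z| ≤ 2 * (ζM + ζv)})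
    (hreg : ∀ k i, IsRegular (z k i, y k i)) :
    ContinuousOn (risk loss z y) (feasibleSet r K ζM ζv) := by
  simp only [funext risk_eq_sum]
  refine continuousOn_finsetSum _ fun q _ => hL.continuousOn.comp (by fun_prop) fun θ hθ => ?_
  change |y q.1 q.2 * inner ℝ (feature q.1 (z q.1 q.2)) θ| ≤ _
  rw [(hreg q.1 q.2).abs_mul]
  exact abs_inner_feature_le hθ q.1 (hreg q.1 q.2).1.1 (hreg q.1 q.2).1.2

theorem isEstimate_iff {A : Matrix (Fin r) (Fin r) ℝ} :
    IsEstimate loss ζM ζv z y A ↔ ∃ θ ∈ feasibleSet r K ζM ζv, unvecMatrix θ.fst = A ∧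
      ∀ θ' ∈ feasibleSet r K ζM ζv, risk loss z y θ ≤ risk loss z y θ' := by
  constructor
  · rintro ⟨w, hw, hmin⟩
    exact ⟨WithLp.toLp 2 (vecMatrix A, WithLp.toLp 2 w), hw, rfl, fun θ' hθ' => hmin _ _ hθ'⟩
  · rintro ⟨θ, hθ, rfl, hmin⟩
    exact ⟨fun k => θ.snd k, hθ, fun A' w' h' =>
      hmin (WithLp.toLp 2 (vecMatrix A', WithLp.toLp 2 w')) h'⟩

theorem exists_isEstimate {L : ℝ≥0} (hL : LipschitzOnWith L loss {z : ℝ | |z| ≤ 2 * (ζM + ζv)})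
    (hreg : ∀ k i, IsRegular (z k i, y k i)) (hne : (feasibleSet r K ζM ζv).Nonempty) :
    ∃ A, IsEstimate loss ζM ζv z y A := by
  obtain ⟨θ, hθ, hmin⟩ :=
    (isCompact_feasibleSet r K ζM ζv).exists_isMinOn hne (continuousOn_risk hL hreg)
  exact ⟨_, isEstimate_iff.mpr ⟨θ, hθ, rfl, fun θ' hθ' => hmin hθ'⟩⟩

theorem sum_lossDiff_eq {Ω : Type*} {D : Fin K → Ω → ItemPairs r m} {Y : Fin K → Fin m → Ω → ℝ}
    (θ₀ θ : JointParam r K) (ω : Ω) :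
    ∑ q : Fin K × Fin m, lossDiff loss θ₀ θ q.1 (observation D Y q ω) =
      risk loss (fun k => D k ω) (fun k i => Y k i ω) θ -
        risk loss (fun k => D k ω) (fun k i => Y k i ω) θ₀ := by
  rw [risk_eq_sum, risk_eq_sum, ← Finset.sum_sub_distrib]
  rfl

end Risk

end MetricLearning

end

/-! ### The error bound for the maximum likelihood estimate -/

open MetricLearning

theorem mainTheorem6 {r m K : ℕ} (hm : 0 < m) (hK : 0 < K)
    {Ω : Type*} [MeasurableSpace Ω] (μ : Measure Ω) [IsProbabilityMeasure μ]
    -- the link function and its constants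
    (ζM ζv cf : ℝ) (L : ℝ≥0) (hζM : 0 < ζM) (hζv : 0 < ζv) (hcf : 0 < cf)
    (f : ℝ → ℝ) (hf : MetricLearning.IsLinkFunction f)
    (hderiv : ∀ z : ℝ, |z| ≤ 2 * (ζM + ζv) → DifferentiableAt ℝ f z ∧ cf ≤ deriv f z)
    (hLip : LipschitzOnWith L (fun z => -Real.log (f z)) {z : ℝ | |z| ≤ 2 * (ζM + ζv)})
    -- the metric and the users
    (Q : Matrix (Fin r) (Fin r) ℝ) (hQ : Q.PosDef) (hQζ : ‖Q‖ ≤ ζM)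
    (u : Fin K → MetricLearning.Item r)
    (hv : ∀ k, ‖MetricLearning.pseudoIdealPoint Q (u k)‖ ≤ ζv)
    -- the items and the distribution over designs
    (𝒳 : Set (MetricLearning.Item r)) (h𝒳 : ∀ x ∈ 𝒳, ‖x‖ ≤ 1)
    (P : Measure (MetricLearning.ItemPairs r m)) [IsProbabilityMeasure P]
    (hP𝒳 : ∀ᵐ z ∂P, ∀ i, (z i).1 ∈ 𝒳 ∧ (z i).2 ∈ 𝒳)
    (hPindep : iIndepFun (fun (i : Fin m) (z : MetricLearning.ItemPairs r m) => z i) P)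
    (hσ : 0 < MetricLearning.sigmaMinSq P)
    -- the random data
    (D : Fin K → Ω → MetricLearning.ItemPairs r m) (Y : Fin K → Fin m → Ω → ℝ)
    (hmodel : MetricLearning.IsResponseModel μ f Q u P D Y)
    (p : ℝ) (hp : 0 < p) (hp1 : p ≤ 1) :
    ∃ E : Set Ω, MeasurableSet E ∧ ENNReal.ofReal (1 - p) ≤ μ E ∧ ∀ ω ∈ E,
      (∃ Qhat : Matrix (Fin r) (Fin r) ℝ,
        MetricLearning.IsEstimate (fun z => -Real.log (f z)) ζM ζv
          (fun k => D k ω) (fun k i => Y k i ω) Qhat) ∧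
      ∀ Qhat : Matrix (Fin r) (Fin r) ℝ,
        MetricLearning.IsEstimate (fun z => -Real.log (f z)) ζM ζv
          (fun k => D k ω) (fun k i => Y k i ω) Qhat →
        Qhat.PosSemidef ∧
          ‖Qhat - Q‖ ^ 2 ≤ 16 * (L : ℝ) / (cf ^ 2 * MetricLearning.sigmaMinSq P) *
            √((ζM ^ 2 + K * ζv ^ 2) * Real.log (4 / p) / (m * K)) := by
  have : Nonempty (Fin K × Fin m) := ⟨⟨0, hK⟩, ⟨0, hm⟩⟩
  have hQs := hQ.posSemidef
  have hPball : ∀ᵐ z ∂P, ∀ i, ‖(z i).1‖ ≤ 1 ∧ ‖(z i).2‖ ≤ 1 := by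
    filter_upwards [hP𝒳] with z hz i using ⟨h𝒳 _ (hz i).1, h𝒳 _ (hz i).2⟩
  have hθ₀ : trueParam Q u ∈ feasibleSet r K ζM ζv := ⟨hQs, hQζ, hv⟩
  have : Nonempty (feasibleSet r K ζM ζv) := ⟨⟨_, hθ₀⟩⟩
  -- The deviation is controlled along a dense sequence and extended by continuity below.
  let e : ℕ → feasibleSet r K ζM ζv := TopologicalSpace.denseSeq (feasibleSet r K ζM ζv)
  have hL0 := hf.lipschitz_constant_pos (by positivity : 0 < 2 * (ζM + ζv)) hLip
  have hind : iIndepFun (observation D Y) μ :=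
    (hmodel.isSignModel hf hQs hPindep).iIndepFun_prodMk
  obtain ⟨E, hE, hpE, hdev⟩ := exists_measurableSet_deviation_le hmodel.measurable_observation hind
    (hmodel.ae_isRegular hPball) Prod.fst hf.measurable_loss hLip hL0 hζM hθ₀
    (e := fun n => e n) (fun n => (e n).2) hp hp1
  have hball := hmodel.ae_norm_le hPball
  -- On this measurable set of full measure all items lie in the unit ball, so existence of a
  -- minimizer and continuity of the risk hold at every point of the final event.
  let G : Set Ω := {ω | ∀ q : Fin K × Fin m, D q.1 ω q.2 ∈
    {a : Item r × Item r | ‖a.1‖ ≤ 1 ∧ ‖a.2‖ ≤ 1}}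
  have hG : MeasurableSet G := measurableSet_forall_mem
    (fun q : Fin K × Fin m => (measurable_pi_apply q.2).comp (hmodel.measurable_design q.1))
    fun _ => measurableSet_norm_le
  have hGae : ∀ᵐ ω ∂μ, ω ∈ G := by
    filter_upwards [hball] with ω hω q using hω q.1 q.2
  refine ⟨E ∩ G, hE.inter hG, ?_, ?_⟩
  · rwa [Set.inter_comm, Measure.measure_inter_eq_of_ae hGae]
  rintro ω ⟨hωE, hωG⟩
  have hreg : ∀ k i, IsRegular (D k ω i, Y k i ω) := fun k i =>
    ⟨hωG (k, i), hmodel.response_sign k i ω⟩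
  refine ⟨exists_isEstimate hLip hreg ⟨_, hθ₀⟩, fun Qhat hQhat => ?_⟩
  obtain ⟨θ, hθ, rfl, hmin⟩ := isEstimate_iff.mp hQhat
  refine ⟨hθ.1, ?_⟩
  set T := 16 * (L : ℝ) * √((ζM ^ 2 + K * ζv ^ 2) * Real.log (4 / p) *
    Fintype.card (Fin K × Fin m)) with hT
  have hall : ∀ η : feasibleSet r K ζM ζv,
      cf ^ 2 * (m * K * sigmaMinSq P) * ‖η.1.fst - vecMatrix Q‖ ^ 2 ≤
        risk (fun z => -Real.log (f z)) (fun k => D k ω) (fun k i => Y k i ω) η.1 -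
        risk (fun z => -Real.log (f z)) (fun k => D k ω) (fun k i => Y k i ω) (trueParam Q u) +
        T := by
    intro η
    refine (TopologicalSpace.denseRange_denseSeq (feasibleSet r K ζM ζv)).induction_on
      (p := fun η => cf ^ 2 * (m * K * sigmaMinSq P) * ‖η.1.fst - vecMatrix Q‖ ^ 2 ≤
        risk (fun z => -Real.log (f z)) (fun k => D k ω) (fun k i => Y k i ω) η.1 -
        risk (fun z => -Real.log (f z)) (fun k => D k ω) (fun k i => Y k i ω) (trueParam Q u) +
        T) η ?_ fun n => ?_
    · refine isClosed_le (by fun_prop) ?_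
      have := continuousOn_iff_continuous_domRestrict.mp (continuousOn_risk hLip hreg)
      exact (this.sub continuous_const).add continuous_const
    · have h1 := hmodel.le_expected_lossDiff hf hm hQs hcf.le hderiv hLip hPindep hPball hσ hθ₀
        (e n).2
      have h2 := hdev ω hωE n
      rw [deviation, Finset.sum_sub_distrib, sum_lossDiff_eq] at h2
      change _ * ‖(e n).1.fst - _‖ ^ 2 ≤ risk _ _ _ (e n).1 - _ + T
      linarith
  -- The truth is feasible, so the minimizer's empirical excess risk is at most 0 and only `T`
  -- remains.
  have hfin := (hall ⟨θ, hθ⟩).trans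
    (add_le_of_nonpos_left (sub_nonpos.mpr (hmin _ hθ₀)))
  have hnorm : ‖unvecMatrix θ.fst - Q‖ = ‖θ.fst - vecMatrix Q‖ := by
    rw [← norm_vecMatrix, vecMatrix_sub, vecMatrix_unvecMatrix]
  rw [hnorm]
  have hm' : (0 : ℝ) < m := by exact_mod_cast hm
  have hK' : (0 : ℝ) < K := by exact_mod_cast hK
  have hcard : ((Fintype.card (Fin K × Fin m) : ℕ) : ℝ) = m * K := by
    simp [mul_comm]
  have hsqrt : √((ζM ^ 2 + K * ζv ^ 2) * Real.log (4 / p) * (m * K)) =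
      √((ζM ^ 2 + K * ζv ^ 2) * Real.log (4 / p) / (m * K)) * (m * K) := by
    rw [← Real.sqrt_sq (mul_pos hm' hK').le, ← Real.sqrt_mul' _ (sq_nonneg _),
      Real.sqrt_sq (mul_pos hm' hK').le]
    congr 1
    field_simp
  rw [hT, hcard, hsqrt] at hfin
  rw [div_mul_eq_mul_div, le_div_iff₀ (by positivity)]
  refine le_of_mul_le_mul_right ?_ (mul_pos hm' hK')
  calc ‖θ.fst - vecMatrix Q‖ ^ 2 * (cf ^ 2 * sigmaMinSq P) * (m * K)
      = cf ^ 2 * (m * K * sigmaMinSq P) * ‖θ.fst - vecMatrix Q‖ ^ 2 := by ring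
    _ ≤ _ := hfin
    _ = _ := by ring
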